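/- Let $\mathbb K$ be a commutative ring, $R$ a unital associative $\mathbb K$-algebra and $M$ an $R$-bimodule (on which $\mathbb K$ acts the same way from both sides). **Shukla cohomology.** Let $\varepsilon:A_*\to R$ be any quasi-free resolution: $A_*$ is a non-negatively graded chain algebra over $\mathbb K$ whose underlying graded algebra is free on homogeneous generators, and $\varepsilon$ is a morphism of chain algebras ($R$ being concentrated in degree $0$) that induces an isomorphism in homology. $\mathrm{Shukla}^n(R,M)$ is the $n$-th cohomology of the total complex of the Hochschild bicomplex $C^{p,q}=\mathrm{Hom}_{\mathbb K}((A_*^{\otimes p})_q,M)$, with $M$ an $A_*$-bimodule via $\varepsilon$ and with differential $D=\delta+(-1)^{p+1}\partial^*$ on $C^{p,q}$, where $\delta$ is the Hochschild coboundary and $\partial^*$ is composition with the differential of $A_*^{\otimes p}$. The statement holds for every such resolution. **Crossed extensions.** A crossed extension of $R$ by $M$ is an exact sequence $$0\to M\xrightarrow{\iota} C_1 \xrightarrow{\ \partial\ } C_0\xrightarrow{\pi} R\to 0 \qquad(\partial)$$ where $C_0$ is a unital $\mathbb K$-algebra, $\pi$ is a homomorphism of unital $\mathbb K$-algebras, $C_1$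 is a $C_0$-bimodule, $\partial$ is a homomorphism of $C_0$-bimodules with $\partial(c)c'=c\,\partial(c')$ for $c,c'\in C_1$, and the $R$-bimodule structure induced on $M$ is the given one. Consider the chain algebra $C_*=(\cdots\to 0\to M\to C_1\to C_0)$ with $M$ in degree $2$, whose products are the bimodule actions when one factor has degree $0$ and are zero otherwise. The class of $(\partial)$ in $\mathrm{Shukla}^3(R,M)$ is the class of the cocycle $f_2:A_2\to M$ (in bidegree $p=1$, $q=2$), where $f_*:A_*\to C_*$ is a morphism of chain algebras over $R$. **$\partial$-extensions.** A $\partial$-extension of $C_1$ by $R$ is a short exact sequence $0\to C_1\xrightarrow{\mu}S\xrightarrow{\sigma}R\to0$, where $S$ is a unital $\mathbb K$-algebra, $\sigma$ is a homomorphism of unital $\mathbb K$-algebras and $\mu$ is $\mathbb K$-linear, together with a homomorphism of unital $\mathbb K$-algebras $\xi:S\to C_0$ such that $\xi\mu=\partial$, $\pi\xi=\sigma$, $\mu(x)s=\mu(x\xi(s))$ and $s\mu(x)=\mu(\xi(s)x)$ for $x\in C_1$, $s\in S$. A morphism $S\to S'$ is a homomorphism of unital $\mathbb K$-algebras compatible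 with $\mu,\sigma,\xi$ and $\mu',\sigma',\xi'$. Let ${}_\partial\mathrm{Ext}(R,C_1)$ be the set of connected components of the category of $\partial$-extensions. **Theorem.** 1. The class of $(\partial)$ in $\mathrm{Shukla}^3(R,M)$ exists and is unique (it does not depend on $f_*$), and it is zero if and only if ${}_\partial\mathrm{Ext}(R,C_1)$ is nonempty. 2. If ${}_\partial\mathrm{Ext}(R,C_1)$ is nonempty, then the group $\mathrm{Shukla}^2(R,M)$ acts on ${}_\partial\mathrm{Ext}(R,C_1)$ transitively and effectively (that is, simply transitively). The action is the following one: $c+[S]=[S']$ if and only if there are morphisms over $R$ of chain algebras $f_*:A_*\to(C_1\xrightarrow{\mu}S)$ and $g_*:A_*\to(C_1\xrightarrow{\mu'}S')$ with $\xi f_0=\xi' g_0$, and a linear map $h:A_1\to M$ with $g_1=f_1+\iota h$, such that $h$ (in bidegree $p=1$, $q=1$) is a cocycle with class $c$. Here $S$ and $S'$ are in degree $0$, $C_1$ is in degree $1$, and the product of two elements of $C_1$ in these chain algebras is zero. -/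

import Mathlib

section ShuklaCrossed

universe u v w x y z

/-! ### Chain algebras and quasi-free resolutions -/

section Chain

variable (K : Type u) [CommRing K] (R : Type v) [Ring R] [Algebra K R]
variable {A : Type w} [Ring A] [Algebra K A]

/-- A chain algebra over `K`: the graded algebra `A = ⨁ₙ 𝒜 n` (`n ≥ 0`) with a differential of
degree `-1` satisfying the Leibniz rule. -/
structure ChainAlgebra (𝒜 : ℕ → Submodule K A) [GradedAlgebra 𝒜] where
  d : A →ₗ[K] A
  d_mem : ∀ (n : ℕ) (a : A), a ∈ 𝒜 (n + 1) → d a ∈ 𝒜 n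
  d_zero : ∀ a ∈ 𝒜 0, d a = 0
  d_d : ∀ a, d (d a) = 0
  leibniz : ∀ (n : ℕ) (a b : A), a ∈ 𝒜 n → d (a * b) = d a * b + (-1 : A) ^ n * (a * d b)

/-- The underlying graded algebra is free on a set of homogeneous generators. -/
def IsQuasiFree (𝒜 : ℕ → Submodule K A) : Prop :=
  ∃ (X : Type w) (deg : X → ℕ) (φ : FreeAlgebra K X ≃ₐ[K] A),
    ∀ i, φ (FreeAlgebra.ι K i) ∈ 𝒜 (deg i)

/-- A quasi-free chain algebra with a weak equivalence `ε` to `R`, where `R` is seen as a chain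
algebra concentrated in degree `0`. -/
structure QuasiFreeResolution (𝒜 : ℕ → Submodule K A) [GradedAlgebra 𝒜] extends
    ChainAlgebra K 𝒜 where
  quasiFree : IsQuasiFree K 𝒜
  ε : A →ₐ[K] R
  ε_pos : ∀ n, 0 < n → ∀ a ∈ 𝒜 n, ε a = 0
  ε_d : ∀ a, ε (d a) = 0
  /-- `H_0(A) → R` is surjective -/
  ε_surjective : Function.Surjective ε
  /-- `H_0(A) → R` is injective -/
  exact_zero : ∀ a ∈ 𝒜 0, ε a = 0 → ∃ b ∈ 𝒜 1, d b = a
  /-- `H_n(A) = 0` for `n > 0` -/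
  exact_pos : ∀ n, 0 < n → ∀ a ∈ 𝒜 n, d a = 0 → ∃ b ∈ 𝒜 (n + 1), d b = a

/-- The Koszul sign operator: `a ↦ (-1)^n a` on `𝒜 n`. -/
noncomputable def koszulSign (𝒜 : ℕ → Submodule K A) [GradedAlgebra 𝒜] : A →ₗ[K] A :=
  (DirectSum.toModule K ℕ A fun n => ((-1 : K) ^ n) • (𝒜 n).subtype) ∘ₗ
    (DirectSum.decomposeLinearEquiv 𝒜).toLinearMap

end Chain

/-! ### The Hochschild complex of a chain algebra and Shukla cohomology -/

section Hochschild

variable {K : Type u} [CommRing K] {R : Type v} [Ring R] [Algebra K R]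
variable {A : Type w} [Ring A] [Algebra K A]

/-- Replacing the entries `j`, `j + 1` of a tuple by their product is compatible with updates. -/
theorem contractNth_update {p : ℕ} (j : Fin p) (i : Fin (p + 1)) (m : Fin (p + 1) → A) :
    ∃ (k : Fin p) (L : A →ₗ[K] A), ∀ a : A,
      Fin.contractNth j.castSucc (· * ·) (Function.update m i a) =
        Function.update (Fin.contractNth j.castSucc (· * ·) m) k (L a) := by
  rcases lt_trichotomy i j.castSucc with h | h | h
  · have hi : (i : ℕ) < j := h
    refine ⟨⟨i, by omega⟩, LinearMap.id, fun a => ?_⟩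
    funext k
    simp only [Fin.contractNth, Function.update_apply, Fin.ext_iff, Fin.val_castSucc, Fin.val_succ,
      LinearMap.id_apply]
    split_ifs <;> first | rfl | omega
  · have hi : (i : ℕ) = j := by rw [h]; rfl
    refine ⟨j, LinearMap.mulRight K (m j.succ), fun a => ?_⟩
    funext k
    rcases lt_trichotomy (k : ℕ) j with hk | hk | hk
    · have h1 : k ≠ j := by intro e; subst e; omega
      have h2 : k.castSucc ≠ i := by intro e; subst e; simp at hi; omega
      simp [Fin.contractNth, hk, h1, h2]
    · obtain rfl : k = j := Fin.ext hk
      subst h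
      have h2 : k.succ ≠ k.castSucc := by intro e; simp [Fin.ext_iff] at e
      simp [Fin.contractNth, h2]
    · have h1 : k ≠ j := by intro e; subst e; omega
      have h2 : k.succ ≠ i := by intro e; subst e; simp at hi; omega
      have h3 : ¬ (k : ℕ) < j := by omega
      have h4 : ¬ (k : ℕ) = j := by omega
      simp [Fin.contractNth, h1, h2, h3, h4]
  · have hi : (j : ℕ) < i := h
    by_cases hj : (i : ℕ) = j + 1
    · obtain rfl : i = j.succ := Fin.ext hj
      refine ⟨j, LinearMap.mulLeft K (m j.castSucc), fun a => ?_⟩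
      funext k
      rcases lt_trichotomy (k : ℕ) j with hk | hk | hk
      · have h1 : k ≠ j := by intro e; subst e; omega
        have h2 : k.castSucc ≠ j.succ := by intro e; simp [Fin.ext_iff] at e; omega
        simp [Fin.contractNth, hk, h1, h2]
      · obtain rfl : k = j := Fin.ext hk
        have h2 : k.castSucc ≠ k.succ := by intro e; simp [Fin.ext_iff] at e
        simp [Fin.contractNth, h2]
      · have h1 : k ≠ j := by intro e; subst e; omega
        have h3 : ¬ (k : ℕ) < j := by omega
        have h4 : ¬ (k : ℕ) = j := by omega
        simp [Fin.contractNth, h1, h3, h4]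
    · refine ⟨⟨i - 1, by omega⟩, LinearMap.id, fun a => ?_⟩
      funext k
      simp only [Fin.contractNth, Function.update_apply, Fin.ext_iff, Fin.val_castSucc,
        Fin.val_succ, LinearMap.id_apply]
      split_ifs <;> first | rfl | omega

variable {𝒜 : ℕ → Submodule K A} [GradedAlgebra 𝒜] (P : QuasiFreeResolution K R 𝒜)
variable (M : Type x) [AddCommGroup M] [Module K M] [Module R M] [Module Rᵐᵒᵖ M]
  [IsScalarTower K R M] [IsScalarTower K Rᵐᵒᵖ M]

/-- The face `f ↦ ((a₀, …, a_p) ↦ a₀ f (a₁, …, a_p))`; here `A` acts on `M` through `ε`. -/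
def faceLeft (p : ℕ) : MultilinearMap K (fun _ : Fin p => A) M →ₗ[K]
    MultilinearMap K (fun _ : Fin (p + 1) => A) M where
  toFun f := LinearMap.uncurryLeft (M := fun _ : Fin (p + 1) => A)
    { toFun := fun a => (P.ε a) • f
      map_add' := fun a b => by rw [map_add, add_smul]
      map_smul' := fun c a => by
        ext m; simp [smul_assoc] }
  map_add' f g := by ext m; simp
  map_smul' c f := by
    ext m; simp [smul_comm c]

/-- The face `f ↦ ((a₀, …, a_p) ↦ f (a₀, …, a_{p-1}) a_p)`. -/
def faceRight (p : ℕ) : MultilinearMap K (fun _ : Fin p => A) M →ₗ[K]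
    MultilinearMap K (fun _ : Fin (p + 1) => A) M where
  toFun f := MultilinearMap.uncurryRight (M := fun _ : Fin (p + 1) => A)
    (((LinearMap.mk₂ K (fun (m : M) (a : A) => MulOpposite.op (P.ε a) • m)
      (fun m n a => smul_add _ _ _) (fun c m a => (smul_comm _ _ _))
      (fun m a b => by simp [add_smul])
      (fun c m a => by simp [smul_assoc])).compMultilinearMap f))
  map_add' f g := by ext m; simp
  map_smul' c f := by ext m; simp [smul_comm c]

/-- The face `f ↦ ((a₀, …, a_p) ↦ f (a₀, …, a_j a_{j+1}, …, a_p))`. -/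
def faceMiddle {p : ℕ} (j : Fin p) : MultilinearMap K (fun _ : Fin p => A) M →ₗ[K]
    MultilinearMap K (fun _ : Fin (p + 1) => A) M where
  toFun f :=
    { toFun := fun a => f (Fin.contractNth j.castSucc (· * ·) a)
      map_update_add' := fun {inst} m i a b => by
        obtain rfl : inst = instDecidableEqFin _ := Subsingleton.elim _ _
        obtain ⟨k, L, h⟩ := contractNth_update (K := K) j i m
        simp [h]
      map_update_smul' := fun {inst} m i c a => by
        obtain rfl : inst = instDecidableEqFin _ := Subsingleton.elim _ _
        obtain ⟨k, L, h⟩ := contractNth_update (K := K) j i m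
        simp [h] }
  map_add' f g := by ext m; simp
  map_smul' c f := by ext m; simp

/-- The Hochschild coboundary
`a₀ f(a₁,…,a_p) + ∑_{1 ≤ i ≤ p} (-1)^i f(…,a_{i-1} a_i,…) + (-1)^{p+1} f(a₀,…,a_{p-1}) a_p`. -/
def hochschildCoboundary (p : ℕ) : MultilinearMap K (fun _ : Fin p => A) M →ₗ[K]
    MultilinearMap K (fun _ : Fin (p + 1) => A) M :=
  faceLeft P M p + (∑ j : Fin p, (-1 : K) ^ ((j : ℕ) + 1) • faceMiddle M j)
    + (-1 : K) ^ (p + 1) • faceRight P M p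

/-- The dual of the differential of the complex `A ⊗ ⋯ ⊗ A` (`p` factors):
`f ↦ ((a₁, …, a_p) ↦ ∑ᵢ (-1)^{|a₁| + ⋯ + |a_{i-1}|} f (a₁, …, d aᵢ, …, a_p))`. -/
noncomputable def internalCoboundary (p : ℕ) : MultilinearMap K (fun _ : Fin p => A) M →ₗ[K]
    MultilinearMap K (fun _ : Fin p => A) M :=
  ∑ i : Fin p, MultilinearMap.compLinearMapₗ
    (fun j : Fin p => if j < i then koszulSign K 𝒜 else if j = i then P.d else LinearMap.id)

/-- The components `A ⊗ ⋯ ⊗ A → M` (`p` factors) of a Hochschild cochain, for all `p`. -/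
abbrev Cochain (K : Type u) [CommRing K] (A : Type w) [Ring A] [Algebra K A]
    (M : Type x) [AddCommGroup M] [Module K M] :=
  (p : ℕ) → MultilinearMap K (fun _ : Fin p => A) M

/-- The differential of the total complex of the bicomplex `Hom ((A ^ ⊗ p)_q, M)`. -/
noncomputable def totalDifferential : Cochain K A M →ₗ[K] Cochain K A M :=
  LinearMap.pi fun p => match p with
    | 0 => 0
    | p + 1 => hochschildCoboundary P M p ∘ₗ LinearMap.proj p
        + (-1 : K) ^ p • (internalCoboundary P M (p + 1) ∘ₗ LinearMap.proj (p + 1))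

/-- The total cochains of degree `n`: the `p`-th component lives on the part of degree `n - p` of
the graded module `A ⊗ ⋯ ⊗ A` (`p` factors). -/
def totalCochains (𝒜 : ℕ → Submodule K A) (n : ℕ) : Submodule K (Cochain K A M) where
  carrier := {f | ∀ (p : ℕ) (k : Fin p → ℕ) (a : Fin p → A), (∀ i, a i ∈ 𝒜 (k i)) →
    p + ∑ i, k i ≠ n → f p a = 0}
  add_mem' hf hg p k a ha hk := by simp [hf p k a ha hk, hg p k a ha hk]
  zero_mem' p k a ha hk := rfl
  smul_mem' c f hf p k a ha hk := by simp [hf p k a ha hk]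

noncomputable def cocycles (n : ℕ) : Submodule K (Cochain K A M) :=
  totalCochains M 𝒜 n ⊓ LinearMap.ker (totalDifferential P M)

noncomputable def coboundaries : ℕ → Submodule K (Cochain K A M)
  | 0 => ⊥
  | n + 1 => (totalCochains M 𝒜 n).map (totalDifferential P M)

/-- `Shuklaⁿ(R, M)`: the `n`-th Hochschild cohomology, with coefficients in `M`, of the quasi-free
resolution `P` of `R`. -/
abbrev Shukla (n : ℕ) : Type (max w x) :=
  cocycles P M n ⧸ (coboundaries P M n).comap (cocycles P M n).subtype

variable {M}

/-- A linear map `A → M` as a cochain, concentrated in tensor degree `p = 1`. -/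
def cochainOfLinear (h : A →ₗ[K] M) : Cochain K A M
  | 1 => MultilinearMap.ofSubsingleton K A M (0 : Fin 1) h
  | _ => 0

/-- `h : A → M` is a cocycle of degree `n` and its class is `c`. -/
def Represents {n : ℕ} (c : Shukla P M n) (h : A →ₗ[K] M) : Prop :=
  ∃ z : cocycles P M n, z.1 = cochainOfLinear h ∧ Submodule.Quotient.mk z = c

end Hochschild

/-! ### Crossed extensions and `∂`-extensions -/

section Crossed

variable (K : Type u) [CommRing K] (R : Type v) [Ring R] [Algebra K R]
variable (M : Type x) [AddCommGroup M] [Module K M] [Module R M] [Module Rᵐᵒᵖ M]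
variable (C₁ : Type y) [AddCommGroup C₁] [Module K C₁]
variable (C₀ : Type z) [Ring C₀] [Algebra K C₀] [Module C₀ C₁] [Module C₀ᵐᵒᵖ C₁]

/-- A crossed extension `0 → M → C₁ → C₀ → R → 0` of `R` by the `R`-bimodule `M`, where `C₁` is a
bimodule over the `K`-algebra `C₀`. -/
structure CrossedExtension where
  ι : M →ₗ[K] C₁
  del : C₁ →ₗ[K] C₀
  π : C₀ →ₐ[K] R
  del_smul : ∀ (x : C₀) (c : C₁), del (x • c) = x * del c
  del_op_smul : ∀ (x : C₀) (c : C₁), del (MulOpposite.op x • c) = del c * x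
  /-- `∂(c) c' = c ∂(c')` -/
  crossed : ∀ c c' : C₁, del c • c' = MulOpposite.op (del c') • c
  ι_injective : Function.Injective ι
  exact_ι_del : ∀ c, del c = 0 ↔ ∃ m, ι m = c
  exact_del_π : ∀ x, π x = 0 ↔ ∃ c, del c = x
  π_surjective : Function.Surjective π
  /-- the given `R`-bimodule structure of `M` is the one induced from the crossed bimodule -/
  ι_smul : ∀ (x : C₀) (m : M), ι (π x • m) = x • ι m
  ι_op_smul : ∀ (x : C₀) (m : M), ι (MulOpposite.op (π x) • m) = MulOpposite.op x • ι m

namespace CrossedExtension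

variable {K R M C₁ C₀}
variable (E : CrossedExtension K R M C₁ C₀)

/-- A `∂`-extension of `C₁` by `R`. -/
structure DelExtension where
  S : Type (max v y)
  [ring : Ring S]
  [algebra : Algebra K S]
  μ : C₁ →ₗ[K] S
  σ : S →ₐ[K] R
  ξ : S →ₐ[K] C₀
  μ_injective : Function.Injective μ
  exact : ∀ s, σ s = 0 ↔ ∃ c, μ c = s
  σ_surjective : Function.Surjective σ
  ξ_μ : ∀ c, ξ (μ c) = E.del c
  π_ξ : ∀ s, E.π (ξ s) = σ s
  μ_mul : ∀ (c : C₁) (s : S), μ c * s = μ (MulOpposite.op (ξ s) • c)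
  mul_μ : ∀ (s : S) (c : C₁), s * μ c = μ (ξ s • c)

attribute [instance] DelExtension.ring DelExtension.algebra

/-- Morphisms of `∂`-extensions: identity on `C₁`, `R` and on the bottom row. -/
structure DelExtension.Hom {E : CrossedExtension K R M C₁ C₀} (X Y : E.DelExtension) where
  φ : X.S →ₐ[K] Y.S
  φ_μ : ∀ c, φ (X.μ c) = Y.μ c
  σ_φ : ∀ s, Y.σ (φ s) = X.σ s
  ξ_φ : ∀ s, Y.ξ (φ s) = X.ξ s

/-- `_∂Ext(R, C₁)`: the set of connected components of the category of `∂`-extensions. -/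
def DelExt : Type _ := Quot fun X Y : E.DelExtension => Nonempty (X.Hom Y)

/-- The component of a `∂`-extension. -/
def DelExtension.component {E : CrossedExtension K R M C₁ C₀} (X : E.DelExtension) : E.DelExt :=
  Quot.mk _ X

section Class

variable {A : Type w} [Ring A] [Algebra K A] {𝒜 : ℕ → Submodule K A} [GradedAlgebra 𝒜]
variable (P : QuasiFreeResolution K R 𝒜)

/-- A morphism of chain algebras over `R` from the resolution to
`C_* = (⋯ → 0 → M → C₁ → C₀)`, in components `fₙ : A → Cₙ` that vanish on `𝒜 k` for `k ≠ n`.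
In `C_*` the products `C_i × C_j → C_{i+j}` are the bimodule actions if `i = 0` or `j = 0`
(`C₀` acts on `M` through `π`), and zero otherwise. -/
structure Lift where
  f₀ : A →ₐ[K] C₀
  f₁ : A →ₗ[K] C₁
  f₂ : A →ₗ[K] M
  f₀_degree : ∀ n, n ≠ 0 → ∀ a ∈ 𝒜 n, f₀ a = 0
  f₁_degree : ∀ n, n ≠ 1 → ∀ a ∈ 𝒜 n, f₁ a = 0
  f₂_degree : ∀ n, n ≠ 2 → ∀ a ∈ 𝒜 n, f₂ a = 0
  π_f₀ : ∀ a, E.π (f₀ a) = P.ε a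
  f₁_mul : ∀ a b, f₁ (a * b) = f₀ a • f₁ b + MulOpposite.op (f₀ b) • f₁ a
  f₂_mul : ∀ a b, f₂ (a * b) = P.ε a • f₂ b + MulOpposite.op (P.ε b) • f₂ a
  del_f₁ : ∀ a, E.del (f₁ a) = f₀ (P.d a)
  ι_f₂ : ∀ a, E.ι (f₂ a) = f₁ (P.d a)
  f₂_d : ∀ a, f₂ (P.d a) = 0

variable {P} in
/-- A morphism of chain algebras over `R` from the resolution to the chain algebra
`S_* = (⋯ → 0 → C₁ → S)` with differential `μ`, where `C₁` is an `S`-bimodule through `ξ`. -/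
structure DelExtension.Lift {E : CrossedExtension K R M C₁ C₀} (X : E.DelExtension)
    (P : QuasiFreeResolution K R 𝒜) where
  f₀ : A →ₐ[K] X.S
  f₁ : A →ₗ[K] C₁
  f₀_degree : ∀ n, n ≠ 0 → ∀ a ∈ 𝒜 n, f₀ a = 0
  f₁_degree : ∀ n, n ≠ 1 → ∀ a ∈ 𝒜 n, f₁ a = 0
  σ_f₀ : ∀ a, X.σ (f₀ a) = P.ε a
  f₁_mul : ∀ a b, f₁ (a * b) = X.ξ (f₀ a) • f₁ b + MulOpposite.op (X.ξ (f₀ b)) • f₁ a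
  μ_f₁ : ∀ a, X.μ (f₁ a) = f₀ (P.d a)
  f₁_d : ∀ a, f₁ (P.d a) = 0

variable [IsScalarTower K R M] [IsScalarTower K Rᵐᵒᵖ M]

/-- `c` is the class of the crossed extension in `Shukla³(R, M)`: it is the class of the
component `f₂` of a lift. -/
def IsClass (c : Shukla P M 3) : Prop :=
  ∃ f : E.Lift P, Represents P c f.f₂

/-- `c ∈ Shukla²(R, M)` is the difference class of the `∂`-extensions `X` and `Y`: there are lifts
`f`, `g` to `X`, `Y` over the same map to `C₀`, such that `g₁ - f₁ = ι h` where `h` represents `c`. -/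
def IsDifference {E : CrossedExtension K R M C₁ C₀} (X Y : E.DelExtension)
    (c : Shukla P M 2) : Prop :=
  ∃ (f : X.Lift P) (g : Y.Lift P) (h : A →ₗ[K] M),
    (∀ a, Y.ξ (g.f₀ a) = X.ξ (f.f₀ a)) ∧
    (∀ a, g.f₁ a = f.f₁ a + E.ι (h a)) ∧ Represents P c h

end Class

end CrossedExtension

end Crossed

end ShuklaCrossed

/-! Everything reduces to derivations on the resolution A. On a free algebra every Hochschild
2-cocycle is a coboundary (`IsFreeOn.exists_linear_of_cocycle`). Hence a total cochain of degree 2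
whose differential lies in tensor degree 1 is, up to a coboundary, a derivation A → M of degree 1
(`exists_derivation_of_totalCochains_two`). So Shukla² consists of the degree-1 derivations
vanishing on boundaries, modulo the maps e ∘ d with e a degree-0 derivation, and the class of f₂ in
Shukla³ is zero exactly when f₂ = v ∘ d for a degree-1 derivation v.

Freeness also produces lifts, generator by generator, and homotopies between them: if ∂H = f₀ - g₀
with H a derivation along (f₀, g₀), then f₁ - g₁ - H d lands in M, is a derivation, and composed
with d gives f₂ - g₂ (`Lift.class_unique`).

The bridge to ∂-extensions is a quotient. If f₂ = 0, then f₁ kills boundaries, hence all 1-cycles,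
so C₁ embeds in S = (A₀ ⊕ C₁) / {(-d b, f₁ b)} (`Lift.exists_delExtension`). Conversely, a lift to a
∂-extension is a lift to C_* with f₂ = 0 and exhibits S as this very quotient
(`f₀_add_μ_eq_zero_iff`), so f₀ over C₀ and f₁ determine the ∂-extension. For part 1, if f₂ = v ∘ d,
replacing f₁ by f₁ - ι v makes f₂ zero.

For part 2, lifts to X and Y over the same map to C₀ have g₁ - f₁ = ι h with h a derivation. The
class of h is independent of the lifts, additive, takes every value, and vanishes exactly when X and
Y lie in one component. Simple transitivity is then formal. -/

/-! ### Free algebras on a family of generators -/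

section FreeOn

variable {K : Type*} [CommRing K] {A : Type*} [Ring A] [Algebra K A]

/-- `A` is the free `K`-algebra on the family `x`. -/
abbrev IsFreeOn (K : Type*) [CommRing K] {A : Type*} [Ring A] [Algebra K A] {X : Type*} (x : X → A) :
    Prop :=
  Function.Bijective (FreeAlgebra.lift K x)

theorem IsQuasiFree.exists_isFreeOn.{w} {A : Type w} [Ring A] [Algebra K A]
    {𝒜 : ℕ → Submodule K A} (h : IsQuasiFree K 𝒜) :
    ∃ (X : Type w) (deg : X → ℕ) (x : X → A), (∀ i, x i ∈ 𝒜 (deg i)) ∧ IsFreeOn K x := by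
  obtain ⟨X, deg, φ, hφ⟩ := h
  refine ⟨X, deg, fun i => φ (FreeAlgebra.ι K i), hφ, ?_⟩
  have : FreeAlgebra.lift K (fun i => φ (FreeAlgebra.ι K i)) = φ.toAlgHom := by
    ext i; simp
  rw [IsFreeOn, this]
  exact φ.bijective

namespace IsFreeOn

variable {X : Type*} {x : X → A}

theorem induction (hx : IsFreeOn K x) {p : A → Prop} (scalar : ∀ r, p (algebraMap K A r))
    (gen : ∀ i, p (x i)) (mul : ∀ a b, p a → p b → p (a * b))
    (add : ∀ a b, p a → p b → p (a + b)) (a : A) : p a := by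
  obtain ⟨w, rfl⟩ := hx.surjective a
  induction w with
  | grade0 r => simpa using scalar r
  | grade1 i => simpa using gen i
  | mul a b ha hb => simpa using mul _ _ ha hb
  | add a b ha hb => simpa using add _ _ ha hb

theorem exists_algHom (hx : IsFreeOn K x) {B : Type*} [Ring B] [Algebra K B] (v : X → B) :
    ∃ f : A →ₐ[K] B, ∀ i, f (x i) = v i := by
  refine ⟨(FreeAlgebra.lift K v).comp (AlgEquiv.ofBijective _ hx).symm.toAlgHom, fun i => ?_⟩
  have : (AlgEquiv.ofBijective _ hx).symm (x i) = FreeAlgebra.ι K i := by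
    rw [AlgEquiv.symm_apply_eq]; simp
  simp [this]

theorem algHom_ext (hx : IsFreeOn K x) {B : Type*} [Ring B] [Algebra K B] {f g : A →ₐ[K] B}
    (h : ∀ i, f (x i) = g (x i)) : f = g := by
  ext a
  induction a using hx.induction with
  | scalar r => simp
  | gen i => exact h i
  | mul a b ha hb => simp [ha, hb]
  | add a b ha hb => simp [ha, hb]

variable {B : Type*} [Ring B] [Algebra K B]
variable {N : Type*} [AddCommGroup N] [Module K N] [Module B N] [Module Bᵐᵒᵖ N]

/-- Two derivations along `f` and `g` that agree on the generators are equal. -/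
theorem derivation_ext (hx : IsFreeOn K x) {f g : A →ₐ[K] B} {D D' : A →ₗ[K] N}
    (hD : ∀ a b, D (a * b) = f a • D b + MulOpposite.op (g b) • D a)
    (hD' : ∀ a b, D' (a * b) = f a • D' b + MulOpposite.op (g b) • D' a)
    (h : ∀ i, D (x i) = D' (x i)) : D = D' := by
  have h1 : D 1 = 0 := by simpa using hD 1 1
  have h1' : D' 1 = 0 := by simpa using hD' 1 1
  ext a
  induction a using hx.induction with
  | scalar r => simp [Algebra.algebraMap_eq_smul_one, h1, h1']
  | gen i => exact h i
  | mul a b ha hb => rw [hD, hD', ha, hb]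
  | add a b ha hb => simp [ha, hb]

variable [IsScalarTower K B N] [IsScalarTower K Bᵐᵒᵖ N] [SMulCommClass B Bᵐᵒᵖ N]

/-- On a free algebra every Hochschild `2`-cocycle `c` with values in a bimodule is the coboundary
of a linear map with prescribed values on the generators. -/
theorem exists_linear_of_cocycle (hx : IsFreeOn K x) (f g : A →ₐ[K] B) (c : A →ₗ[K] A →ₗ[K] N)
    (hc : ∀ a b b', f a • c b b' - c (a * b) b' + c a (b * b') - MulOpposite.op (g b') • c a b = 0)
    (v : X → N) :
    ∃ e : A →ₗ[K] N, (∀ i, e (x i) = v i) ∧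
      ∀ a b, e (a * b) = f a • e b + MulOpposite.op (g b) • e a - c a b := by
  have sc : SMulCommClass B K N := SMulCommClass.symm _ _ _
  have sc' : SMulCommClass Bᵐᵒᵖ K N := SMulCommClass.symm _ _ _
  -- The cocycle identity with two arguments equal to 1 determines `c` whenever one argument is 1;
  -- `c` is not assumed normalized.
  have c1 : ∀ a, c 1 a = MulOpposite.op (g a) • c 1 1 := fun a => by
    have := hc 1 1 a
    simp only [map_one, one_smul, one_mul, sub_self, zero_add] at this
    exact sub_eq_zero.1 this
  have c1' : ∀ a, c a 1 = f a • c 1 1 := fun a => by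
    have := hc a 1 1
    simp only [map_one, MulOpposite.op_one, one_smul, mul_one] at this
    rw [add_sub_assoc, sub_self, add_zero] at this
    exact (sub_eq_zero.1 this).symm
  -- The desired identity says that twisted left multiplication on `A × N` preserves the graph of
  -- `e`. Over a free algebra this action can be prescribed on generators, and `e` is read off from
  -- the orbit of `(1, c 1 1)`; the case `a = b = 1` forces `e 1 = c 1 1`.
  obtain ⟨ρ, hρ⟩ := hx.exists_algHom (B := Module.End K (A × N)) fun i =>
    LinearMap.prod (LinearMap.mulLeft K (x i) ∘ₗ LinearMap.fst K A N)
      (Module.toModuleEnd K N (f (x i)) ∘ₗ LinearMap.snd K A N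
        + (-c (x i)
          + (LinearMap.mk₂ K (fun (n : N) (a : A) => MulOpposite.op (g a) • n)
              (fun m n a => smul_add _ _ _) (fun r m a => (smul_comm _ _ _))
              (fun m a b => by simp [add_smul]) (fun r m a => by simp [smul_assoc])) (v i))
            ∘ₗ LinearMap.fst K A N)
  have hρx : ∀ i a n, ρ (x i) (a, n) =
      (x i * a, f (x i) • n + (MulOpposite.op (g a) • v i - c (x i) a)) := fun i a n => by
    rw [hρ]
    ext
    · simp
    · simp; abel
  have hρ1 : ∀ b a n, ρ b (a, n) = (b * a, (ρ b (a, n)).2) := by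
    intro b
    induction b using hx.induction with
    | scalar r => intro a n; simp [Algebra.algebraMap_eq_smul_one]
    | gen i => intro a n; simp [hρx]
    | mul a b ha hb =>
      intro a' n
      rw [map_mul, Module.End.mul_apply, hb, ha]
      simp [mul_assoc]
    | add a b ha hb =>
      intro a' n
      ext
      · rw [map_add, LinearMap.add_apply, Prod.fst_add, ha, hb, add_mul]
      · rfl
  let e : A →ₗ[K] N := LinearMap.snd K A N ∘ₗ
    ((LinearMap.applyₗ ((1 : A), c 1 1)) ∘ₗ ρ.toLinearMap)
  have he : ∀ a, ρ a (1, c 1 1) = (a, e a) := fun a => by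
    rw [hρ1]; simp [e]
  have he' : ∀ b a, ρ b (a, e a) = (b * a, e (b * a)) := fun b a => by
    rw [← he, ← he, map_mul, Module.End.mul_apply]
  have hex : ∀ i a, e (x i * a) = f (x i) • e a + (MulOpposite.op (g a) • v i - c (x i) a) :=
    fun i a => by
      have := he' (x i) a
      rw [hρx] at this
      exact (congrArg Prod.snd this).symm
  have he1 : e 1 = c 1 1 := by
    have := he 1
    rw [map_one] at this
    exact (congrArg Prod.snd this).symm
  have hev : ∀ i, e (x i) = v i := fun i => by
    have := hex i 1
    rw [mul_one, he1, c1' (x i)] at this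
    simpa using this
  -- The identity holds by construction for a generator on the left; the cocycle condition
  -- propagates it to products.
  refine ⟨e, hev, fun a => ?_⟩
  induction a using hx.induction with
  | scalar r => intro b; simp [Algebra.algebraMap_eq_smul_one, he1, c1 b, smul_comm r]
  | gen i => intro b; rw [hex, hev]; abel
  | mul a b ha hb =>
    intro d
    have := hc a b d
    rw [mul_assoc, ha, hb, ha]
    simp only [map_mul, mul_smul, MulOpposite.op_mul, smul_add, smul_sub,
      smul_comm (f a) (MulOpposite.op (g d))]
    rw [← sub_eq_zero, ← neg_eq_zero, ← this]
    abel
  | add a b ha hb =>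
    intro d
    simp only [add_mul, map_add, ha, hb, add_smul, smul_add, LinearMap.add_apply]
    abel

/-- On a free algebra there is a derivation with prescribed values on the generators. -/
theorem exists_derivation (hx : IsFreeOn K x) (f g : A →ₐ[K] B) (v : X → N) :
    ∃ D : A →ₗ[K] N, (∀ i, D (x i) = v i) ∧
      ∀ a b, D (a * b) = f a • D b + MulOpposite.op (g b) • D a := by
  simpa using hx.exists_linear_of_cocycle f g (0 : A →ₗ[K] A →ₗ[K] N) (by simp) v

end IsFreeOn

end FreeOn

/-! ### Graded algebras -/

section Graded

variable {K : Type*} [CommRing K] {A : Type*} [Ring A] [Algebra K A]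

/-- The projection of a graded algebra to its part of degree `0`. -/
def projZero (𝒜 : ℕ → Submodule K A) [GradedAlgebra 𝒜] : A →ₐ[K] A :=
  { GradedRing.projZeroRingHom 𝒜 with
    commutes' := fun r =>
      DirectSum.decompose_of_mem_same 𝒜 (SetLike.algebraMap_mem_graded 𝒜 r) }

variable {𝒜 : ℕ → Submodule K A} [GradedAlgebra 𝒜]

theorem projZero_mem (a : A) : projZero 𝒜 a ∈ 𝒜 0 :=
  (DirectSum.decompose 𝒜 a 0).2

theorem projZero_of_mem {a : A} (ha : a ∈ 𝒜 0) : projZero 𝒜 a = a :=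
  DirectSum.decompose_of_mem_same 𝒜 ha

theorem projZero_of_ne {n : ℕ} {a : A} (ha : a ∈ 𝒜 n) (hn : n ≠ 0) : projZero 𝒜 a = 0 :=
  DirectSum.decompose_of_mem_ne 𝒜 ha hn

theorem homogeneous_induction (𝒜 : ℕ → Submodule K A) [GradedAlgebra 𝒜] {p : A → Prop}
    (h : ∀ n, ∀ a ∈ 𝒜 n, p a) (add : ∀ a b, p a → p b → p (a + b)) (a : A) : p a :=
  DirectSum.Decomposition.inductionOn 𝒜 (h 0 0 (zero_mem _)) (fun m => h _ m m.2) add a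

theorem homogeneous_induction₂ (𝒜 : ℕ → Submodule K A) [GradedAlgebra 𝒜] {p : A → A → Prop}
    (h : ∀ k l, ∀ a ∈ 𝒜 k, ∀ b ∈ 𝒜 l, p a b)
    (add_left : ∀ a a' b, p a b → p a' b → p (a + a') b)
    (add_right : ∀ a b b', p a b → p a b' → p a (b + b')) (a b : A) : p a b := by
  induction a using homogeneous_induction 𝒜 with
  | h k a ha =>
    induction b using homogeneous_induction 𝒜 with
    | h l b hb => exact h k l a ha b hb
    | add b b' h h' => exact add_right _ _ _ h h'
  | add a a' h h' => exact add_left _ _ _ h h'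

/-- A linear map that vanishes off `𝒜 n` is determined by its restriction to `𝒜 n`. -/
theorem comp_proj_eq {N : Type*} [AddCommGroup N] [Module K N] {n : ℕ} {D : A →ₗ[K] N}
    (hD : ∀ k, k ≠ n → ∀ a ∈ 𝒜 k, D a = 0) (a : A) : D (GradedAlgebra.proj 𝒜 n a) = D a := by
  induction a using homogeneous_induction 𝒜 with
  | h k a ha =>
    by_cases hk : k = n
    · subst hk; rw [GradedAlgebra.proj_apply, DirectSum.decompose_of_mem_same 𝒜 ha]
    · rw [GradedAlgebra.proj_apply, DirectSum.decompose_of_mem_ne 𝒜 ha hk, hD k hk a ha, map_zero]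
  | add a b ha hb => simp only [map_add, ha, hb]

/-- A multilinear map that vanishes on tuples of homogeneous elements is zero. -/
theorem multilinear_eq_zero {N : Type*} [AddCommGroup N] [Module K N] {p : ℕ}
    (f : MultilinearMap K (fun _ : Fin p => A) N)
    (h : ∀ (k : Fin p → ℕ) (a : Fin p → A), (∀ i, a i ∈ 𝒜 (k i)) → f a = 0) : f = 0 := by
  classical
  -- `s` is the set of positions whose entries are not yet known to be homogeneous; these are
  -- decomposed one at a time.
  have key : ∀ (s : Finset (Fin p)) (a : Fin p → A), (∀ i ∉ s, ∃ k, a i ∈ 𝒜 k) → f a = 0 := by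
    intro s
    induction s using Finset.induction with
    | empty =>
      intro a ha
      choose k hk using fun i => ha i (by simp)
      exact h k a hk
    | insert i s _ ih =>
      intro a ha
      have : ∀ b, f (Function.update a i b) = 0 := fun b => by
        induction b using homogeneous_induction 𝒜 with
        | h k b hb =>
          refine ih _ fun j hj => ?_
          by_cases hji : j = i
          · subst hji; exact ⟨k, by simpa using hb⟩
          · simpa [hji] using ha j (by simp [hj, hji])
        | add b b' hb hb' => rw [f.map_update_add, hb, hb', add_zero]
      simpa using this (a i)
  ext a
  exact key Finset.univ a (by simp)

theorem algHom_projZero {B : Type*} [Ring B] [Algebra K B] {f : A →ₐ[K] B}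
    (hf : ∀ n, n ≠ 0 → ∀ a ∈ 𝒜 n, f a = 0) (a : A) : f (projZero 𝒜 a) = f a :=
  comp_proj_eq (D := f.toLinearMap) hf a

variable {X : Type*} {deg : X → ℕ} {x : X → A}

theorem IsFreeOn.algHom_degree (hx : IsFreeOn K x) (hdeg : ∀ i, x i ∈ 𝒜 (deg i))
    {B : Type*} [Ring B] [Algebra K B] {f : A →ₐ[K] B} (hf : ∀ i, deg i ≠ 0 → f (x i) = 0)
    (n : ℕ) (hn : n ≠ 0) (a : A) (ha : a ∈ 𝒜 n) : f a = 0 := by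
  have : f.comp (projZero 𝒜) = f := hx.algHom_ext fun i => by
    by_cases hi : deg i = 0
    · simp [projZero_of_mem (hi ▸ hdeg i)]
    · simp [projZero_of_ne (hdeg i) hi, hf i hi]
  rw [← this, AlgHom.comp_apply, projZero_of_ne ha hn, map_zero]

/-- Since `f` and `g` kill positive degrees, a term of the product rule survives only if the acting
factor has degree 0. Truncating `D` to degree `n` therefore gives another derivation, equal to `D`
on generators. -/
theorem IsFreeOn.derivation_degree (hx : IsFreeOn K x) (hdeg : ∀ i, x i ∈ 𝒜 (deg i))
    {B : Type*} [Ring B] [Algebra K B]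
    {N : Type*} [AddCommGroup N] [Module K N] [Module B N] [Module Bᵐᵒᵖ N]
    {f g : A →ₐ[K] B} (hf : ∀ n, n ≠ 0 → ∀ a ∈ 𝒜 n, f a = 0)
    (hg : ∀ n, n ≠ 0 → ∀ a ∈ 𝒜 n, g a = 0) {D : A →ₗ[K] N}
    (hD : ∀ a b, D (a * b) = f a • D b + MulOpposite.op (g b) • D a)
    {n : ℕ} (h : ∀ i, deg i ≠ n → D (x i) = 0) (k : ℕ) (hk : k ≠ n) (a : A) (ha : a ∈ 𝒜 k) :
    D a = 0 := by
  have same : ∀ b ∈ 𝒜 n, GradedAlgebra.proj 𝒜 n b = b := fun b hb =>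
    DirectSum.decompose_of_mem_same 𝒜 hb
  have ne : ∀ m, m ≠ n → ∀ b ∈ 𝒜 m, GradedAlgebra.proj 𝒜 n b = 0 := fun m hm b hb =>
    DirectSum.decompose_of_mem_ne 𝒜 hb hm
  have : D ∘ₗ GradedAlgebra.proj 𝒜 n = D := by
    refine hx.derivation_ext (f := f) (g := g) (fun a b => ?_) hD fun i => ?_
    · simp only [LinearMap.comp_apply]
      refine homogeneous_induction₂ 𝒜 (p := fun a b => D (GradedAlgebra.proj 𝒜 n (a * b)) =
        f a • D (GradedAlgebra.proj 𝒜 n b) + MulOpposite.op (g b) • D (GradedAlgebra.proj 𝒜 n a))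
        ?_ ?_ ?_ a b
      · intro k l a ha b hb
        have hab := SetLike.mul_mem_graded ha hb
        have t1 : f a • D (GradedAlgebra.proj 𝒜 n b) =
            if k + l = n then f a • D b else 0 := by
          by_cases hk : k = 0
          · subst hk
            split_ifs with e
            · rw [same b (by simpa [← e] using hb)]
            · rw [ne l (by omega) b hb]; simp
          · simp [hf k hk a ha]
        have t2 : MulOpposite.op (g b) • D (GradedAlgebra.proj 𝒜 n a) =
            if k + l = n then MulOpposite.op (g b) • D a else 0 := by
          by_cases hl : l = 0
          · subst hl
            split_ifs with e
            · rw [same a (by simpa [← e] using ha)]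
            · rw [ne k (by omega) a ha]; simp
          · simp [hg l hl b hb]
        rw [t1, t2]
        split_ifs with e
        · rw [same _ (by simpa [← e] using hab), hD]
        · rw [ne _ e _ hab]; simp
      · intro a a' b h h'
        simp only [add_mul, map_add, h, h', add_smul, smul_add]; abel
      · intro a b b' h h'
        simp only [mul_add, map_add, h, h', add_smul, smul_add, MulOpposite.op_add]; abel
    · by_cases hi : deg i = n
      · simp only [LinearMap.comp_apply]; rw [same _ (hi ▸ hdeg i)]
      · simp only [LinearMap.comp_apply]; rw [ne _ hi _ (hdeg i), h i hi, map_zero]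
  rw [← this, LinearMap.comp_apply, ne k hk a ha, map_zero]

end Graded

/-! ### The semidirect product of an algebra over `C₀` with the crossed bimodule -/

section Semidirect

set_option linter.unusedSectionVars false

namespace CrossedExtension

variable {K : Type*} [CommRing K] {R : Type*} [Ring R] [Algebra K R]
variable {M : Type*} [AddCommGroup M] [Module K M] [Module R M] [Module Rᵐᵒᵖ M]
variable {C₁ : Type*} [AddCommGroup C₁] [Module K C₁]
variable {C₀ : Type*} [Ring C₀] [Algebra K C₀] [Module C₀ C₁] [Module C₀ᵐᵒᵖ C₁]
variable {A : Type*} [Ring A] [Algebra K A]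

/-- The algebra `A ⊕ C₁`, where `A` acts on `C₁` through `f : A → C₀` and the product of `C₁` is
`c c' = ∂(c) c'`. -/
def Semidirect (_ : CrossedExtension K R M C₁ C₀) (_ : A →ₐ[K] C₀) : Type _ := A × C₁

namespace Semidirect

variable {E : CrossedExtension K R M C₁ C₀} {f : A →ₐ[K] C₀}

instance : AddCommGroup (E.Semidirect f) := inferInstanceAs (AddCommGroup (A × C₁))

instance : Module K (E.Semidirect f) := inferInstanceAs (Module K (A × C₁))

instance : One (E.Semidirect f) := ⟨((1, 0) : A × C₁)⟩

instance : Mul (E.Semidirect f) :=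
  ⟨fun s t => ((s.1 * t.1,
    f s.1 • t.2 + MulOpposite.op (f t.1) • s.2 + E.del s.2 • t.2) : A × C₁)⟩

@[ext]
theorem ext {s t : E.Semidirect f} (h₁ : s.1 = t.1) (h₂ : s.2 = t.2) : s = t := Prod.ext h₁ h₂

@[simp] theorem add_fst (s t : E.Semidirect f) : (s + t).1 = s.1 + t.1 := rfl
@[simp] theorem add_snd (s t : E.Semidirect f) : (s + t).2 = s.2 + t.2 := rfl
@[simp] theorem zero_fst : (0 : E.Semidirect f).1 = 0 := rfl
@[simp] theorem zero_snd : (0 : E.Semidirect f).2 = 0 := rfl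
@[simp] theorem one_fst : (1 : E.Semidirect f).1 = 1 := rfl
@[simp] theorem one_snd : (1 : E.Semidirect f).2 = 0 := rfl
@[simp] theorem smul_fst (r : K) (s : E.Semidirect f) : (r • s).1 = r • s.1 := rfl
@[simp] theorem smul_snd (r : K) (s : E.Semidirect f) : (r • s).2 = r • s.2 := rfl
@[simp] theorem mul_fst (s t : E.Semidirect f) : (s * t).1 = s.1 * t.1 := rfl
@[simp] theorem mul_snd (s t : E.Semidirect f) : (s * t).2 =
    f s.1 • t.2 + MulOpposite.op (f t.1) • s.2 + E.del s.2 • t.2 := rfl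

variable [SMulCommClass C₀ C₀ᵐᵒᵖ C₁]

instance : Ring (E.Semidirect f) :=
  { (inferInstance : AddCommGroup (E.Semidirect f)) with
    one := 1
    mul := (· * ·)
    mul_assoc := fun s t u => by
      ext
      · simp [mul_assoc]
      · simp only [mul_fst, mul_snd, map_add, map_mul, smul_add, mul_smul, MulOpposite.op_mul,
          E.del_smul, E.del_op_smul, add_smul]
        simp only [← smul_comm (f _) (MulOpposite.op (f _)),
          ← smul_comm (E.del _) (MulOpposite.op (f _))]
        abel
    one_mul := fun s => by ext <;> simp
    mul_one := fun s => by ext <;> simp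
    left_distrib := fun s t u => by
      ext
      · simp [mul_add]
      · simp [add_smul, smul_add]; abel
    right_distrib := fun s t u => by
      ext
      · simp [add_mul]
      · simp [add_smul, smul_add]; abel
    zero_mul := fun s => by ext <;> simp
    mul_zero := fun s => by ext <;> simp }

variable [IsScalarTower K C₀ C₁] [IsScalarTower K C₀ᵐᵒᵖ C₁]

instance : Algebra K (E.Semidirect f) :=
  Algebra.ofModule
    (fun r s t => by
      ext
      · simp
      · simp [smul_comm r])
    (fun r s t => by
      have : SMulCommClass C₀ K C₁ := SMulCommClass.symm _ _ _
      ext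
      · simp
      · simp [smul_comm _ r])

/-- The inclusion of `A`. -/
def inl (E : CrossedExtension K R M C₁ C₀) (f : A →ₐ[K] C₀) : A →ₐ[K] E.Semidirect f :=
  AlgHom.ofLinearMap (LinearMap.inl K A C₁ : A →ₗ[K] A × C₁) rfl fun a b => by
    ext
    · rfl
    · change (0 : C₁) = f a • (0 : C₁) + MulOpposite.op (f b) • (0 : C₁) + E.del 0 • (0 : C₁)
      simp

/-- The inclusion of `C₁`. -/
def inr (E : CrossedExtension K R M C₁ C₀) (f : A →ₐ[K] C₀) : C₁ →ₗ[K] E.Semidirect f :=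
  (LinearMap.inr K A C₁ : C₁ →ₗ[K] A × C₁)

@[simp] theorem inl_fst (a : A) : (inl E f a).1 = a := rfl
@[simp] theorem inl_snd (a : A) : (inl E f a).2 = 0 := rfl
@[simp] theorem inr_fst (c : C₁) : (inr E f c).1 = 0 := rfl
@[simp] theorem inr_snd (c : C₁) : (inr E f c).2 = c := rfl

/-- The projection to `A`. -/
def fst (E : CrossedExtension K R M C₁ C₀) (f : A →ₐ[K] C₀) : E.Semidirect f →ₐ[K] A :=
  AlgHom.ofLinearMap (LinearMap.fst K A C₁ : A × C₁ →ₗ[K] A) rfl fun _ _ => rfl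

/-- The homomorphism `(a, c) ↦ f(a) + ∂(c)`. -/
def toBase (E : CrossedExtension K R M C₁ C₀) (f : A →ₐ[K] C₀) : E.Semidirect f →ₐ[K] C₀ :=
  AlgHom.ofLinearMap (LinearMap.coprod f.toLinearMap E.del : A × C₁ →ₗ[K] C₀)
    (by change f 1 + E.del 0 = 1; simp) fun s t => by
      change f (s * t).1 + E.del (s * t).2 = (f s.1 + E.del s.2) * (f t.1 + E.del t.2)
      simp only [mul_fst, mul_snd, map_mul, map_add, E.del_smul, E.del_op_smul]
      noncomm_ring

@[simp] theorem toBase_apply (s : E.Semidirect f) : toBase E f s = f s.1 + E.del s.2 := rfl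

/-- A homomorphism `g` from `A` to a `∂`-extension `S` over `C₀` extends to the semidirect product
by `(a, c) ↦ g(a) + μ(c)`. -/
def lift (X : E.DelExtension) (g : A →ₐ[K] X.S) (hg : ∀ a, X.ξ (g a) = f a) :
    E.Semidirect f →ₐ[K] X.S :=
  AlgHom.ofLinearMap (LinearMap.coprod g.toLinearMap X.μ : A × C₁ →ₗ[K] X.S)
    (by change g 1 + X.μ 0 = 1; simp) fun s t => by
      change g (s * t).1 + X.μ (s * t).2 = (g s.1 + X.μ s.2) * (g t.1 + X.μ t.2)
      simp only [mul_fst, mul_snd, map_mul, map_add, mul_add, add_mul, X.mul_μ, X.μ_mul, hg,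
        X.ξ_μ, E.crossed, add_smul]
      abel

end Semidirect

end CrossedExtension

end Semidirect

/-! ### Algebra homomorphisms out of a quotient and `∂`-extensions in other universes -/

section Transfer

theorem AlgHom.exists_of_surjective {K T B C : Type*} [CommRing K] [Ring T] [Ring B] [Ring C]
    [Algebra K T] [Algebra K B] [Algebra K C] (p : T →ₐ[K] B) (hp : Function.Surjective p)
    (g : T →ₐ[K] C) (h : ∀ t, p t = 0 → g t = 0) : ∃ φ : B →ₐ[K] C, ∀ t, φ (p t) = g t := by
  refine ⟨(Ideal.Quotient.liftₐ (RingHom.ker p) g h).comp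
    (Ideal.quotientKerAlgEquivOfSurjective hp).symm.toAlgHom, fun t => ?_⟩
  have : (Ideal.quotientKerAlgEquivOfSurjective hp).symm (p t) = Ideal.Quotient.mk _ t := by
    rw [AlgEquiv.symm_apply_eq]; rfl
  exact (congrArg (Ideal.Quotient.liftₐ (RingHom.ker p) g h) this).trans
    (Ideal.Quotient.lift_mk _ _ _)

namespace CrossedExtension

universe v y

variable {K : Type*} [CommRing K] {R : Type v} [Ring R] [Algebra K R]
variable {M : Type*} [AddCommGroup M] [Module K M] [Module R M] [Module Rᵐᵒᵖ M]
variable {C₁ : Type y} [AddCommGroup C₁] [Module K C₁]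
variable {C₀ : Type*} [Ring C₀] [Algebra K C₀] [Module C₀ C₁] [Module C₀ᵐᵒᵖ C₁]
variable (E : CrossedExtension K R M C₁ C₀)

/-- The data of a `∂`-extension on an algebra in an arbitrary universe define an isomorphic
`∂`-extension. -/
theorem exists_delExtension {S : Type*} [Ring S] [Algebra K S] (μ : C₁ →ₗ[K] S) (σ : S →ₐ[K] R)
    (ξ : S →ₐ[K] C₀) (μ_injective : Function.Injective μ) (exact : ∀ s, σ s = 0 ↔ ∃ c, μ c = s)
    (σ_surjective : Function.Surjective σ) (ξ_μ : ∀ c, ξ (μ c) = E.del c)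
    (π_ξ : ∀ s, E.π (ξ s) = σ s) (μ_mul : ∀ c s, μ c * s = μ (MulOpposite.op (ξ s) • c))
    (mul_μ : ∀ s c, s * μ c = μ (ξ s • c)) :
    ∃ (X : E.DelExtension) (e : S ≃ₐ[K] X.S), (∀ c, X.μ c = e (μ c)) ∧
      (∀ s, X.σ (e s) = σ s) ∧ ∀ s, X.ξ (e s) = ξ s := by
  -- Each element of `S` is a chosen lift of its image in `R` plus an element of `C₁`, so `S` is a
  -- quotient of the set `R × C₁`.
  have small : Small.{max v y} S := small_of_surjective
    (f := fun q : R × C₁ => Function.surjInv σ_surjective q.1 + μ q.2) fun s => by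
      obtain ⟨c, hc⟩ := (exact (s - Function.surjInv σ_surjective (σ s))).1 (by
        rw [map_sub, Function.surjInv_eq σ_surjective, sub_self])
      exact ⟨(σ s, c), by simp [hc]⟩
  let e := (Shrink.algEquiv.{max v y} K S).symm
  refine ⟨{ S := Shrink.{max v y} S
            μ := e.toLinearMap ∘ₗ μ
            σ := σ.comp e.symm.toAlgHom
            ξ := ξ.comp e.symm.toAlgHom
            μ_injective := e.injective.comp μ_injective
            exact := fun s => ?_
            σ_surjective := σ_surjective.comp e.symm.surjective
            ξ_μ := fun c => by simp [ξ_μ]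
            π_ξ := fun s => by simp [π_ξ]
            μ_mul := fun c s => ?_
            mul_μ := fun s c => ?_ }, e, fun c => rfl, fun s => by simp, fun s => by simp⟩
  · obtain ⟨s, rfl⟩ := e.surjective s
    simp [exact]
  · obtain ⟨s, rfl⟩ := e.surjective s
    simp [← μ_mul]
  · obtain ⟨s, rfl⟩ := e.surjective s
    simp [← mul_μ]

end CrossedExtension

end Transfer

/-! ### The Hochschild complex in low degrees -/

section HochschildLow

variable {K : Type*} [CommRing K] {R : Type*} [Ring R] [Algebra K R]
variable {A : Type*} [Ring A] [Algebra K A] {𝒜 : ℕ → Submodule K A} [GradedAlgebra 𝒜]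
variable {M : Type*} [AddCommGroup M] [Module K M]

theorem koszulSign_of_mem {n : ℕ} {a : A} (ha : a ∈ 𝒜 n) :
    koszulSign K 𝒜 a = (-1 : K) ^ n • a := by
  simp only [koszulSign, LinearMap.comp_apply, LinearEquiv.coe_coe]
  rw [DirectSum.decomposeLinearEquiv_apply, DirectSum.decompose_of_mem 𝒜 ha,
    ← DirectSum.lof_eq_of K, DirectSum.toModule_lof]
  rfl

/-- A linear map as a multilinear map in one variable. -/
abbrev multilinearOfLinear (h : A →ₗ[K] M) : MultilinearMap K (fun _ : Fin 1 => A) M :=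
  MultilinearMap.ofSubsingleton K A M (0 : Fin 1) h

theorem exists_multilinearOfLinear (f : MultilinearMap K (fun _ : Fin 1 => A) M) :
    ∃ h : A →ₗ[K] M, f = multilinearOfLinear h :=
  ⟨(MultilinearMap.ofSubsingleton K A M (0 : Fin 1)).symm f, by simp⟩

theorem exists_bilinear (f : MultilinearMap K (fun _ : Fin 2 => A) M) :
    ∃ c : A →ₗ[K] A →ₗ[K] M, ∀ a b, c a b = f ![a, b] := by
  have upd0 : ∀ a a' b : A, Function.update ![a, b] 0 a' = ![a', b] := fun a a' b => by
    ext i; fin_cases i <;> simp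
  have upd1 : ∀ a b b' : A, Function.update ![a, b] 1 b' = ![a, b'] := fun a b b' => by
    ext i; fin_cases i <;> simp
  refine ⟨LinearMap.mk₂ K (fun a b => f ![a, b]) ?_ ?_ ?_ ?_, fun a b => rfl⟩
  · intro a a' b; simpa only [upd0] using f.map_update_add ![a, b] 0 a a'
  · intro r a b; simpa only [upd0] using f.map_update_smul ![a, b] 0 r a
  · intro a b b'; simpa only [upd1] using f.map_update_add ![a, b] 1 b b'
  · intro r a b; simpa only [upd1] using f.map_update_smul ![a, b] 1 r b

variable (P : QuasiFreeResolution K R 𝒜)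

/-- The Leibniz rule after a linear map. -/
theorem QuasiFreeResolution.map_d_mul {N : Type*} [AddCommGroup N] [Module K N] (D : A →ₗ[K] N)
    {k : ℕ} {a : A} (ha : a ∈ 𝒜 k) (b : A) :
    D (P.d (a * b)) = D (P.d a * b) + (-1 : K) ^ k • D (a * P.d b) := by
  rw [P.leibniz k a b ha, map_add, ← map_smul]
  congr 2
  rcases Nat.even_or_odd k with hk | hk <;> simp [hk.neg_one_pow]

theorem internalCoboundary_one_apply (f : MultilinearMap K (fun _ : Fin 1 => A) M)
    (m : Fin 1 → A) : internalCoboundary P M 1 f m = f (fun i => P.d (m i)) := by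
  simp only [internalCoboundary, Finset.univ_unique, Finset.sum_singleton,
    MultilinearMap.compLinearMapₗ_apply, MultilinearMap.compLinearMap_apply]
  congr 1
  funext i
  obtain rfl := Subsingleton.elim i default
  simp

theorem internalCoboundary_two_apply (f : MultilinearMap K (fun _ : Fin 2 => A) M)
    {k : ℕ} {a : A} (ha : a ∈ 𝒜 k) (b : A) :
    internalCoboundary P M 2 f ![a, b] =
      f ![P.d a, b] + (-1 : K) ^ k • f ![a, P.d b] := by
  simp only [internalCoboundary, Fin.sum_univ_two, LinearMap.add_apply, add_apply,
    MultilinearMap.compLinearMapₗ_apply, MultilinearMap.compLinearMap_apply]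
  congr 1
  · congr 1
    funext i
    fin_cases i <;> simp
  · have := f.map_update_smul ![a, P.d b] 0 ((-1 : K) ^ k) a
    rw [show Function.update ![a, P.d b] 0 a = ![a, P.d b] by ext i; fin_cases i <;> simp] at this
    rw [← this]
    congr 1
    funext i
    fin_cases i <;> simp [koszulSign_of_mem ha]

variable [Module R M] [Module Rᵐᵒᵖ M] [IsScalarTower K R M] [IsScalarTower K Rᵐᵒᵖ M]

theorem hochschildCoboundary_one_apply (h : A →ₗ[K] M) (a b : A) :
    hochschildCoboundary P M 1 (multilinearOfLinear h) ![a, b] =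
      P.ε a • h b - h (a * b) + MulOpposite.op (P.ε b) • h a := by
  simp [hochschildCoboundary, faceLeft, faceRight, faceMiddle, Fin.contractNth, Fin.init,
    sub_eq_add_neg]

theorem hochschildCoboundary_two_apply (f : MultilinearMap K (fun _ : Fin 2 => A) M) (a b c : A) :
    hochschildCoboundary P M 2 f ![a, b, c] =
      P.ε a • f ![b, c] - f ![a * b, c] + f ![a, b * c] - MulOpposite.op (P.ε c) • f ![a, b] := by
  have h0 : Fin.contractNth (0 : Fin 3) (· * ·) ![a, b, c] = ![a * b, c] := by
    ext i; fin_cases i <;> simp [Fin.contractNth]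
  have h1 : Fin.contractNth (1 : Fin 3) (· * ·) ![a, b, c] = ![a, b * c] := by
    ext i; fin_cases i <;> simp [Fin.contractNth]
  have h2 : Fin.init ![a, b, c] = ![a, b] := by
    ext i; fin_cases i <;> simp [Fin.init]
  have h3 : Fin.tail ![a, b, c] = ![b, c] := by
    ext i; fin_cases i <;> simp [Fin.tail]
  simp [hochschildCoboundary, faceLeft, faceRight, faceMiddle, Fin.sum_univ_two, h0, h1, h2, h3,
    show (-1 : K) ^ 3 = -1 by norm_num]
  abel

theorem totalDifferential_zero (f : Cochain K A M) : totalDifferential P M f 0 = 0 := rfl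

theorem totalDifferential_succ (f : Cochain K A M) (p : ℕ) :
    totalDifferential P M f (p + 1) = hochschildCoboundary P M p (f p)
      + (-1 : K) ^ p • internalCoboundary P M (p + 1) (f (p + 1)) := rfl

theorem totalDifferential_cochainOfLinear_one (e : A →ₗ[K] M) :
    totalDifferential P M (cochainOfLinear e) 1 = multilinearOfLinear (e ∘ₗ P.d) := by
  ext m
  rw [totalDifferential_succ]
  simp [cochainOfLinear, internalCoboundary_one_apply]

theorem totalDifferential_cochainOfLinear_two (e : A →ₗ[K] M) :
    totalDifferential P M (cochainOfLinear e) 2 =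
      hochschildCoboundary P M 1 (multilinearOfLinear e) := by
  rw [totalDifferential_succ]
  simp [cochainOfLinear]

theorem totalDifferential_cochainOfLinear_of_two_lt (e : A →ₗ[K] M) {p : ℕ} (hp : 2 < p) :
    totalDifferential P M (cochainOfLinear e) p = 0 := by
  obtain ⟨p, rfl⟩ := Nat.exists_eq_add_of_lt hp
  rw [show 2 + p + 1 = p + 1 + 1 + 1 by omega, totalDifferential_succ]
  simp [cochainOfLinear]

theorem hochschildCoboundary_one_eq_zero_iff (e : A →ₗ[K] M) :
    hochschildCoboundary P M 1 (multilinearOfLinear e) = 0 ↔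
      ∀ a b, e (a * b) = P.ε a • e b + MulOpposite.op (P.ε b) • e a := by
  constructor
  · intro h a b
    have := congrArg (fun f => f ![a, b]) h
    simp only [hochschildCoboundary_one_apply, zero_apply] at this
    rw [← sub_eq_zero, ← neg_eq_zero, ← this]
    abel
  · intro h
    ext m
    obtain ⟨a, b, rfl⟩ : ∃ a b, m = ![a, b] := ⟨m 0, m 1, by ext i; fin_cases i <;> rfl⟩
    rw [hochschildCoboundary_one_apply, h, zero_apply]
    abel

/-- The total differential of a derivation `e` is `e ∘ d`. -/
theorem totalDifferential_derivation {e : A →ₗ[K] M}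
    (he : ∀ a b, e (a * b) = P.ε a • e b + MulOpposite.op (P.ε b) • e a) :
    totalDifferential P M (cochainOfLinear e) = cochainOfLinear (e ∘ₗ P.d) := by
  funext p
  match p with
  | 0 => rfl
  | 1 => exact totalDifferential_cochainOfLinear_one P e
  | 2 =>
    rw [totalDifferential_cochainOfLinear_two, (hochschildCoboundary_one_eq_zero_iff P e).2 he]
    rfl
  | p + 3 =>
    rw [totalDifferential_cochainOfLinear_of_two_lt P e (by omega)]
    rfl

end HochschildLow

/-! ### Cochains of total degree one and two -/

section Cocycles

variable {K : Type*} [CommRing K] {R : Type*} [Ring R] [Algebra K R]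
variable {A : Type*} [Ring A] [Algebra K A] {𝒜 : ℕ → Submodule K A}
variable {M : Type*} [AddCommGroup M] [Module K M]

theorem cochainOfLinear_injective :
    Function.Injective (cochainOfLinear : (A →ₗ[K] M) → Cochain K A M) := fun _ _ e =>
  (MultilinearMap.ofSubsingleton K A M (0 : Fin 1)).injective (congrFun e 1)

theorem cochainOfLinear_zero : cochainOfLinear (0 : A →ₗ[K] M) = 0 := by
  funext p
  match p with
  | 0 => rfl
  | 1 => ext; simp [cochainOfLinear]
  | p + 2 => rfl

theorem cochainOfLinear_sub (h h' : A →ₗ[K] M) :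
    cochainOfLinear (h - h') = cochainOfLinear h - cochainOfLinear h' := by
  funext p
  match p with
  | 0 => exact (sub_zero _).symm
  | 1 => ext; simp [cochainOfLinear]
  | p + 2 => exact (sub_zero _).symm

theorem cochainOfLinear_add (h h' : A →ₗ[K] M) :
    cochainOfLinear (h + h') = cochainOfLinear h + cochainOfLinear h' := by
  funext p
  match p with
  | 0 => exact (add_zero _).symm
  | 1 => ext; simp [cochainOfLinear]
  | p + 2 => exact (add_zero _).symm

theorem cochainOfLinear_mem {n : ℕ} {h : A →ₗ[K] M} (hh : ∀ k, k ≠ n → ∀ a ∈ 𝒜 k, h a = 0) :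
    cochainOfLinear h ∈ totalCochains M 𝒜 (n + 1) := by
  intro p k a ha hk
  match p with
  | 0 => rfl
  | 1 =>
    simp only [cochainOfLinear, MultilinearMap.ofSubsingleton_apply_apply]
    refine hh (k 0) (fun e => hk ?_) _ (ha 0)
    simp [e, add_comm]
  | p + 2 => rfl

/-- Internal degrees are nonnegative, so total degree `n` leaves no room for tensor degree above
`n`. -/
theorem eq_zero_of_mem_totalCochains [GradedAlgebra 𝒜] {n : ℕ} {z : Cochain K A M}
    (hz : z ∈ totalCochains M 𝒜 n) {p : ℕ} (hp : n < p) : z p = 0 :=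
  multilinear_eq_zero (𝒜 := 𝒜) (z p) fun k a ha => hz p k a ha (by omega)

theorem apply_zero_of_mem_totalCochains {n : ℕ} {z : Cochain K A M}
    (hz : z ∈ totalCochains M 𝒜 (n + 1)) : z 0 = 0 := by
  ext a
  exact hz 0 (fun i => i.elim0) a (fun i => i.elim0) (by simp)

theorem linear_degree_of_mem_totalCochains {n : ℕ} {z : Cochain K A M} {h : A →ₗ[K] M}
    (hz : z ∈ totalCochains M 𝒜 (n + 1)) (hh : z 1 = multilinearOfLinear h) (k : ℕ) (hk : k ≠ n)
    (a : A) (ha : a ∈ 𝒜 k) : h a = 0 := by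
  have := hz 1 (fun _ => k) (fun _ => a) (fun _ => ha) (by simp; omega)
  simpa [hh] using this

variable [GradedAlgebra 𝒜] (P : QuasiFreeResolution K R 𝒜)
variable [Module R M] [Module Rᵐᵒᵖ M] [IsScalarTower K R M] [IsScalarTower K Rᵐᵒᵖ M]

/-- A cochain of total degree `1` is a linear map on `𝒜 0`, and a derivation if its differential
lives in tensor degree `1`. -/
theorem exists_derivation_of_totalCochains_one {z : Cochain K A M} {w : A →ₗ[K] M}
    (hz : z ∈ totalCochains M 𝒜 1) (hw : totalDifferential P M z = cochainOfLinear w) :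
    ∃ e : A →ₗ[K] M, (∀ k, k ≠ 0 → ∀ a ∈ 𝒜 k, e a = 0) ∧
      (∀ a b, e (a * b) = P.ε a • e b + MulOpposite.op (P.ε b) • e a) ∧ ∀ a, w a = e (P.d a) := by
  obtain ⟨e, he⟩ := exists_multilinearOfLinear (z 1)
  have hze : z = cochainOfLinear e := by
    funext p
    match p with
    | 0 => exact apply_zero_of_mem_totalCochains hz
    | 1 => exact he
    | p + 2 => exact eq_zero_of_mem_totalCochains hz (by omega)
  subst hze
  -- The tensor degree 2 part of the differential of `e` is its Hochschild coboundary, and the right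
  -- side has none.
  have hder := (hochschildCoboundary_one_eq_zero_iff P e).1 <| by
    rw [← totalDifferential_cochainOfLinear_two, hw]; rfl
  refine ⟨e, linear_degree_of_mem_totalCochains hz he, hder, fun a => ?_⟩
  rw [totalDifferential_derivation P hder] at hw
  rw [← cochainOfLinear_injective hw]
  rfl

/-- The square of the total differential vanishes on linear maps. -/
theorem internalCoboundary_hochschildCoboundary_one (e : A →ₗ[K] M) :
    internalCoboundary P M 2 (hochschildCoboundary P M 1 (multilinearOfLinear e)) =
      hochschildCoboundary P M 1 (multilinearOfLinear (e ∘ₗ P.d)) := by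
  ext m
  obtain ⟨a, b, rfl⟩ : ∃ a b, m = ![a, b] := ⟨m 0, m 1, by ext i; fin_cases i <;> rfl⟩
  induction a using homogeneous_induction 𝒜 with
  | h k a ha =>
    rw [internalCoboundary_two_apply P _ ha]
    simp only [hochschildCoboundary_one_apply, LinearMap.comp_apply, P.ε_d, P.map_d_mul e ha,
      zero_smul, MulOpposite.op_zero, smul_add, smul_sub]
    -- The two sides differ by a sign `(-1)^k` on `ε(a) e(d b)`, which vanishes for `k > 0`.
    by_cases hk : k = 0
    · subst hk; simp [P.d_zero a ha]
    · simp [P.ε_pos k (by omega) a ha]; abel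
  | add a a' h h' =>
    have key : ∀ f : MultilinearMap K (fun _ : Fin 2 => A) M,
        f ![a + a', b] = f ![a, b] + f ![a', b] := fun f => by
      obtain ⟨c, hc⟩ := exists_bilinear f
      simp only [← hc, map_add, LinearMap.add_apply]
    rw [key, key, h, h']

/-- On a quasi-free resolution, a cochain of total degree `2` whose differential lives in tensor
degree `1` is cohomologous to a derivation. -/
theorem exists_derivation_of_totalCochains_two [SMulCommClass R Rᵐᵒᵖ M]
    {z : Cochain K A M} {w : A →ₗ[K] M}
    (hz : z ∈ totalCochains M 𝒜 2) (hw : totalDifferential P M z = cochainOfLinear w) :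
    ∃ e v : A →ₗ[K] M, (∀ k, k ≠ 0 → ∀ a ∈ 𝒜 k, e a = 0) ∧
      z - totalDifferential P M (cochainOfLinear e) = cochainOfLinear v ∧
      (∀ k, k ≠ 1 → ∀ a ∈ 𝒜 k, v a = 0) ∧
      (∀ a b, v (a * b) = P.ε a • v b + MulOpposite.op (P.ε b) • v a) ∧ ∀ a, w a = v (P.d a) := by
  obtain ⟨X, deg, x, hdeg, hx⟩ := P.quasiFree.exists_isFreeOn
  have z3 : z 3 = 0 := eq_zero_of_mem_totalCochains hz (by omega)
  -- With `z 3 = 0`, the tensor degree 3 part of the differential is just the Hochschild coboundary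
  -- of `z 2`.
  have hz2 : hochschildCoboundary P M 2 (z 2) = 0 := by
    have := congrFun hw 3
    rw [totalDifferential_succ, z3, map_zero, smul_zero, add_zero] at this
    exact this
  obtain ⟨c, hc⟩ := exists_bilinear (z 2)
  obtain ⟨e', -, he'⟩ := hx.exists_linear_of_cocycle (N := M) P.ε P.ε c (fun a b b' => by
    simp only [hc]
    rw [← hochschildCoboundary_two_apply, hz2, zero_apply]) 0
  have c0 : ∀ k l, k + l ≠ 0 → ∀ a ∈ 𝒜 k, ∀ b ∈ 𝒜 l, c a b = 0 := fun k l hkl a ha b hb =>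
    (hc a b).trans <| hz 2 ![k, l] ![a, b] (by intro i; fin_cases i <;> simpa) (by simpa using by omega)
  -- The bounding map `e'` need not be homogeneous. As `z 2` lives in bidegree (0, 0), the degree-0
  -- part of `e'` still bounds it.
  let e : A →ₗ[K] M := e' ∘ₗ (projZero 𝒜).toLinearMap
  have he : ∀ a, e a = e' (projZero 𝒜 a) := fun a => rfl
  have hcz : ∀ a b, c a b = c (projZero 𝒜 a) (projZero 𝒜 b) := by
    refine homogeneous_induction₂ 𝒜 ?_ ?_ ?_
    · intro k l a ha b hb
      by_cases hk : k = 0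
      · subst hk
        by_cases hl : l = 0
        · subst hl; rw [projZero_of_mem ha, projZero_of_mem hb]
        · rw [projZero_of_ne hb hl, map_zero, c0 0 l (by omega) a ha b hb]
      · rw [projZero_of_ne ha hk, map_zero, LinearMap.zero_apply, c0 k l (by omega) a ha b hb]
    · intro a a' b h h'; simp [h, h']
    · intro a b b' h h'; simp [h, h']
  have hε : ∀ a, P.ε (projZero 𝒜 a) = P.ε a :=
    algHom_projZero fun n hn => P.ε_pos n (by omega)
  have hδe : hochschildCoboundary P M 1 (multilinearOfLinear e) = z 2 := by
    ext m
    obtain ⟨a, b, rfl⟩ : ∃ a b, m = ![a, b] := ⟨m 0, m 1, by ext i; fin_cases i <;> rfl⟩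
    rw [hochschildCoboundary_one_apply, ← hc, hcz, he, he, he, map_mul, he', hε, hε]
    abel
  obtain ⟨z₁, hz₁⟩ := exists_multilinearOfLinear (z 1)
  have hv : z - totalDifferential P M (cochainOfLinear e) = cochainOfLinear (z₁ - e ∘ₗ P.d) := by
    funext p
    rw [Pi.sub_apply]
    match p with
    | 0 =>
      rw [totalDifferential_zero, apply_zero_of_mem_totalCochains hz, sub_zero]
      rfl
    | 1 =>
      rw [totalDifferential_cochainOfLinear_one, hz₁]
      ext; simp [cochainOfLinear]
    | 2 => rw [totalDifferential_cochainOfLinear_two, hδe, sub_self]; rfl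
    | p + 3 =>
      rw [totalDifferential_cochainOfLinear_of_two_lt P e (by omega), sub_zero]
      exact eq_zero_of_mem_totalCochains hz (by omega)
  refine ⟨e, _, fun k hk a ha => by rw [he, projZero_of_ne ha hk, map_zero], hv, ?_, ?_, ?_⟩
  · intro k hk a ha
    rw [LinearMap.sub_apply, linear_degree_of_mem_totalCochains hz hz₁ k hk a ha,
      LinearMap.comp_apply, he, zero_sub, neg_eq_zero]
    match k with
    | 0 => rw [P.d_zero a ha, map_zero, map_zero]
    | k + 1 => rw [projZero_of_ne (P.d_mem k a ha) (by omega), map_zero]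
  · rw [← hochschildCoboundary_one_eq_zero_iff]
    -- In tensor degree 2 the hypothesis reads δ z₁ - ∂* z₂ = 0. Since z₂ = δ e, this becomes δ (z₁
    -- - e ∘ d) = 0.
    have h2 : totalDifferential P M z 2 = 0 := congrFun hw 2
    rw [totalDifferential_succ, hz₁, ← hδe, internalCoboundary_hochschildCoboundary_one, pow_one,
      neg_one_smul, ← map_neg, ← map_add] at h2
    rw [← h2]
    congr 1
    ext; simp [sub_eq_add_neg]
  · intro a
    have h1 : totalDifferential P M z 1 = multilinearOfLinear w := congrFun hw 1
    rw [totalDifferential_succ, hz₁, apply_zero_of_mem_totalCochains hz, map_zero, zero_add,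
      pow_zero, one_smul] at h1
    have := congrArg (fun f => f (fun _ => a)) h1
    rw [internalCoboundary_one_apply] at this
    simpa [P.d_d] using this.symm

end Cocycles

/-! ### Classes represented by derivations -/

section Represents

variable {K : Type*} [CommRing K] {R : Type*} [Ring R] [Algebra K R]
variable {A : Type*} [Ring A] [Algebra K A] {𝒜 : ℕ → Submodule K A} [GradedAlgebra 𝒜]
variable {P : QuasiFreeResolution K R 𝒜}
variable {M : Type*} [AddCommGroup M] [Module K M] [Module R M] [Module Rᵐᵒᵖ M]
  [IsScalarTower K R M] [IsScalarTower K Rᵐᵒᵖ M]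

/-- The shift from `n` to `n + 1` is the contribution of the tensor degree `p = 1`. -/
theorem exists_represents {n : ℕ} {h : A →ₗ[K] M} (hdeg : ∀ k, k ≠ n → ∀ a ∈ 𝒜 k, h a = 0)
    (hder : ∀ a b, h (a * b) = P.ε a • h b + MulOpposite.op (P.ε b) • h a)
    (hd : ∀ a, h (P.d a) = 0) : ∃ c : Shukla P M (n + 1), Represents P c h := by
  refine ⟨_, ⟨cochainOfLinear h, cochainOfLinear_mem hdeg, ?_⟩, rfl, rfl⟩
  change totalDifferential P M (cochainOfLinear h) = 0
  rw [totalDifferential_derivation P hder,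
    show h ∘ₗ P.d = 0 from LinearMap.ext hd, cochainOfLinear_zero]

theorem Represents.congr_iff {n : ℕ} {c c' : Shukla P M (n + 1)} {h h' : A →ₗ[K] M}
    (hc : Represents P c h) (hc' : Represents P c' h') :
    c = c' ↔ ∃ z ∈ totalCochains M 𝒜 n, totalDifferential P M z = cochainOfLinear (h - h') := by
  obtain ⟨z, hz, rfl⟩ := hc
  obtain ⟨z', hz', rfl⟩ := hc'
  rw [Submodule.Quotient.eq, cochainOfLinear_sub, ← hz, ← hz']
  rfl

theorem Represents.add {n : ℕ} {c c' : Shukla P M n} {h h' : A →ₗ[K] M}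
    (hc : Represents P c h) (hc' : Represents P c' h') : Represents P (c + c') (h + h') := by
  obtain ⟨z, hz, rfl⟩ := hc
  obtain ⟨z', hz', rfl⟩ := hc'
  exact ⟨z + z', by rw [cochainOfLinear_add, ← hz, ← hz']; rfl, rfl⟩

theorem represents_zero {n : ℕ} : Represents P (0 : Shukla P M n) 0 :=
  ⟨0, cochainOfLinear_zero.symm, rfl⟩

theorem Represents.eq_of_derivation {n : ℕ} {c c' : Shukla P M (n + 2)} {h h' e : A →ₗ[K] M}
    (hc : Represents P c h) (hc' : Represents P c' h')
    (hdeg : ∀ k, k ≠ n → ∀ a ∈ 𝒜 k, e a = 0)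
    (hder : ∀ a b, e (a * b) = P.ε a • e b + MulOpposite.op (P.ε b) • e a)
    (hd : ∀ a, h a = h' a + e (P.d a)) : c = c' := by
  refine (hc.congr_iff hc').2 ⟨cochainOfLinear e, cochainOfLinear_mem hdeg, ?_⟩
  rw [totalDifferential_derivation P hder]
  congr 1
  ext a
  simp [hd]

/-- Every class of degree `2` is represented by a derivation. -/
theorem exists_represents_of_shukla_two [SMulCommClass R Rᵐᵒᵖ M] (c : Shukla P M 2) :
    ∃ h : A →ₗ[K] M, Represents P c h ∧ (∀ k, k ≠ 1 → ∀ a ∈ 𝒜 k, h a = 0) ∧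
      (∀ a b, h (a * b) = P.ε a • h b + MulOpposite.op (P.ε b) • h a) ∧ ∀ a, h (P.d a) = 0 := by
  obtain ⟨z, rfl⟩ := Submodule.Quotient.mk_surjective _ c
  obtain ⟨e, v, he, hv, hdeg, hder, hd⟩ := exists_derivation_of_totalCochains_two P z.2.1
    (w := 0) (by rw [cochainOfLinear_zero]; exact z.2.2)
  obtain ⟨_, z', hz', -⟩ := exists_represents hdeg hder fun a => (hd a).symm
  refine ⟨v, ⟨z', hz', ?_⟩, hdeg, hder, fun a => (hd a).symm⟩
  rw [eq_comm, Submodule.Quotient.eq]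
  refine ⟨cochainOfLinear e, cochainOfLinear_mem he, ?_⟩
  rw [Submodule.subtype_apply, AddSubgroupClass.coe_sub, hz', ← hv, sub_sub_cancel]

end Represents

/-! ### Lifts of the resolution to crossed extensions and `∂`-extensions -/

section Lifts

/-- Applied to `ι` and `μ`, this yields components and homotopies that are linear at once; their
identities are then checked after the injection. -/
theorem LinearMap.exists_factor {K A C S : Type*} [CommRing K] [AddCommGroup A] [AddCommGroup C]
    [AddCommGroup S] [Module K A] [Module K C] [Module K S] {μ : C →ₗ[K] S}
    (hμ : Function.Injective μ) (g : A →ₗ[K] S) (h : ∀ a, ∃ c, μ c = g a) :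
    ∃ f : A →ₗ[K] C, ∀ a, μ (f a) = g a := by
  refine ⟨(LinearEquiv.ofInjective μ hμ).symm.toLinearMap ∘ₗ g.codRestrict (LinearMap.range μ) h,
    fun a => ?_⟩
  exact congrArg Subtype.val
    ((LinearEquiv.ofInjective μ hμ).apply_symm_apply (g.codRestrict (LinearMap.range μ) h a))

variable {K : Type*} [CommRing K] {R : Type*} [Ring R] [Algebra K R]
variable {A : Type*} [Ring A] [Algebra K A] {𝒜 : ℕ → Submodule K A} [GradedAlgebra 𝒜]

section Resolution

variable (P : QuasiFreeResolution K R 𝒜)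

theorem QuasiFreeResolution.d_mul_of_mem_zero {p : A} (hp : p ∈ 𝒜 0) (b : A) :
    P.d (p * b) = p * P.d b := by
  simp [P.leibniz 0 p b hp, P.d_zero p hp]

theorem QuasiFreeResolution.d_mul_of_mem_zero_right {p : A} (hp : p ∈ 𝒜 0) (b : A) :
    P.d (b * p) = P.d b * p := by
  induction b using homogeneous_induction 𝒜 with
  | h k b hb => simp [P.leibniz k b p hb, P.d_zero p hp]
  | add b b' h h' => simp [add_mul, h, h']

theorem QuasiFreeResolution.projZero_d (b : A) :
    projZero 𝒜 (P.d b) = P.d (GradedAlgebra.proj 𝒜 1 b) := by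
  induction b using homogeneous_induction 𝒜 with
  | h k b hb =>
    match k with
    | 0 =>
      rw [P.d_zero b hb, GradedAlgebra.proj_apply,
        DirectSum.decompose_of_mem_ne 𝒜 hb zero_ne_one, map_zero, map_zero]
    | 1 =>
      rw [GradedAlgebra.proj_apply, DirectSum.decompose_of_mem_same 𝒜 hb,
        projZero_of_mem (P.d_mem 0 b hb)]
    | k + 2 =>
      rw [GradedAlgebra.proj_apply, DirectSum.decompose_of_mem_ne 𝒜 hb (by omega), map_zero,
        projZero_of_ne (P.d_mem _ b hb) (by omega)]
  | add b b' h h' => simp only [map_add, h, h']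

theorem QuasiFreeResolution.ε_projZero (a : A) : P.ε (projZero 𝒜 a) = P.ε a :=
  algHom_projZero (fun n hn => P.ε_pos n (by omega)) a

theorem QuasiFreeResolution.exists_d_eq_projZero {a : A} (ha : P.ε a = 0) :
    ∃ b ∈ 𝒜 1, P.d b = projZero 𝒜 a :=
  P.exact_zero _ (projZero_mem a) (by rw [P.ε_projZero, ha])

end Resolution

namespace CrossedExtension

variable {M : Type*} [AddCommGroup M] [Module K M] [Module R M] [Module Rᵐᵒᵖ M]
variable {C₁ : Type*} [AddCommGroup C₁] [Module K C₁]
variable {C₀ : Type*} [Ring C₀] [Algebra K C₀] [Module C₀ C₁] [Module C₀ᵐᵒᵖ C₁]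
variable {E : CrossedExtension K R M C₁ C₀} {P : QuasiFreeResolution K R 𝒜}

/-- The components `f₀` and `f₁` of a morphism of chain algebras to a crossed extension determine
the component `f₂`. -/
theorem exists_lift_of_truncated (f₀ : A →ₐ[K] C₀) (f₁ : A →ₗ[K] C₁)
    (f₀_degree : ∀ n, n ≠ 0 → ∀ a ∈ 𝒜 n, f₀ a = 0) (f₁_degree : ∀ n, n ≠ 1 → ∀ a ∈ 𝒜 n, f₁ a = 0)
    (π_f₀ : ∀ a, E.π (f₀ a) = P.ε a)
    (f₁_mul : ∀ a b, f₁ (a * b) = f₀ a • f₁ b + MulOpposite.op (f₀ b) • f₁ a)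
    (del_f₁ : ∀ a, E.del (f₁ a) = f₀ (P.d a)) : ∃ F : E.Lift P, F.f₀ = f₀ ∧ F.f₁ = f₁ := by
  -- The map f₂ is forced to be f₁ ∘ d, which lands in M because ∂ f₁ d = f₀ d d = 0.
  obtain ⟨f₂, hf₂⟩ := LinearMap.exists_factor E.ι_injective (f₁ ∘ₗ P.d) fun a =>
    (E.exact_ι_del _).1 (by rw [LinearMap.comp_apply, del_f₁, P.d_d, map_zero])
  simp only [LinearMap.comp_apply] at hf₂
  refine ⟨⟨f₀, f₁, f₂, f₀_degree, f₁_degree, fun n hn a ha => E.ι_injective ?_, π_f₀, f₁_mul,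
    fun a b => E.ι_injective ?_, del_f₁, hf₂, fun a => E.ι_injective ?_⟩, rfl, rfl⟩
  · rw [hf₂, map_zero]
    match n with
    | 0 => rw [P.d_zero a ha, map_zero]
    | n + 1 => exact f₁_degree n (by omega) _ (P.d_mem n a ha)
  · rw [map_add, ← π_f₀, ← π_f₀, E.ι_smul, E.ι_op_smul]
    induction a using homogeneous_induction 𝒜 with
    | h k a ha =>
      rw [hf₂, P.map_d_mul f₁ ha, f₁_mul, f₁_mul, ← hf₂, ← hf₂, ← del_f₁, ← del_f₁, E.crossed]
      -- In degree 0 the terms with f₁ a vanish; in degree 1 the two cross terms are equal by the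
      -- crossed identity and have opposite signs; above, f₀ a and f₁ a are both zero.
      rcases Nat.lt_trichotomy k 1 with hk | rfl | hk
      · obtain rfl : k = 0 := by omega
        simp only [f₁_degree 0 (by omega) a ha, pow_zero, one_smul, smul_zero]
        abel
      · simp only [f₀_degree 1 (by omega) a ha, pow_one, zero_smul, neg_smul, one_smul]
        abel
      · simp [f₀_degree k (by omega) a ha, f₁_degree k (by omega) a ha]
    | add a a' h h' => simp only [add_mul, map_add, h, h', add_smul, smul_add]; abel
  · rw [hf₂, P.d_d, map_zero, map_zero]

/-- Since ∂ι = 0, an M-valued derivation can be subtracted from f₁ without disturbing f₀; the cost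
is v ∘ d in f₂. This both removes an obstruction and moves a ∂-extension by a class. -/
theorem Lift.exists_sub [IsScalarTower K R M] [IsScalarTower K Rᵐᵒᵖ M] (F : E.Lift P)
    {v : A →ₗ[K] M} (hdeg : ∀ k, k ≠ 1 → ∀ a ∈ 𝒜 k, v a = 0)
    (hder : ∀ a b, v (a * b) = P.ε a • v b + MulOpposite.op (P.ε b) • v a) :
    ∃ F' : E.Lift P, F'.f₀ = F.f₀ ∧ (∀ a, F'.f₁ a = F.f₁ a - E.ι (v a)) ∧
      ∀ a, F'.f₂ a = F.f₂ a - v (P.d a) := by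
  obtain ⟨F', h₀, h₁⟩ := exists_lift_of_truncated (E := E) (P := P) F.f₀ (F.f₁ - E.ι ∘ₗ v)
    F.f₀_degree (fun n hn a ha => by simp [F.f₁_degree n hn a ha, hdeg n hn a ha]) F.π_f₀
    (fun a b => by
      simp only [LinearMap.sub_apply, LinearMap.comp_apply, F.f₁_mul, hder, map_add, ← F.π_f₀,
        E.ι_smul, E.ι_op_smul, smul_sub]
      abel)
    (fun a => by
      have : E.del (E.ι (v a)) = 0 := (E.exact_ι_del _).2 ⟨_, rfl⟩
      simp [this, F.del_f₁])
  have h₁' : ∀ a, F'.f₁ a = F.f₁ a - E.ι (v a) := fun a => by rw [h₁]; rfl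
  exact ⟨F', h₀, h₁', fun a => E.ι_injective (by rw [F'.ι_f₂, h₁', map_sub, F.ι_f₂])⟩

/-! ### Existence of lifts and uniqueness of the class -/

section Existence

variable [IsScalarTower K C₀ C₁] [IsScalarTower K C₀ᵐᵒᵖ C₁] [SMulCommClass C₀ C₀ᵐᵒᵖ C₁]

theorem nonempty_lift (E : CrossedExtension K R M C₁ C₀) (P : QuasiFreeResolution K R 𝒜) :
    Nonempty (E.Lift P) := by
  obtain ⟨X, deg, x, hdeg, hx⟩ := P.quasiFree.exists_isFreeOn
  choose v₀ hv₀ using fun i => E.π_surjective (P.ε (x i))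
  obtain ⟨f₀, hf₀⟩ := hx.exists_algHom fun i => if deg i = 0 then v₀ i else 0
  have f₀_degree := hx.algHom_degree hdeg (f := f₀) fun i hi => by simp [hf₀, hi]
  have π_f₀ : ∀ a, E.π (f₀ a) = P.ε a := by
    have : E.π.comp f₀ = P.ε := hx.algHom_ext fun i => by
      by_cases hi : deg i = 0
      · simp [hf₀, hi, hv₀]
      · simp [hf₀, hi, P.ε_pos _ (Nat.pos_of_ne_zero hi) _ (hdeg i)]
    exact fun a => DFunLike.congr_fun this a
  -- Exactness at C₀ applies because ε vanishes on boundaries.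
  choose v₁ hv₁ using fun i => (E.exact_del_π (f₀ (P.d (x i)))).1 (by rw [π_f₀, P.ε_d])
  obtain ⟨f₁, hf₁, f₁_mul⟩ := hx.exists_derivation f₀ f₀ fun i => if deg i = 1 then v₁ i else 0
  have f₁_degree := hx.derivation_degree hdeg f₀_degree f₀_degree f₁_mul (n := 1)
    fun i hi => by simp [hf₁, hi]
  -- Both sides are derivations along f₀: in f₀ ∘ d the Koszul sign only multiplies f₀ a, which is
  -- zero in positive degree.
  have del_f₁ : E.del ∘ₗ f₁ = f₀.toLinearMap ∘ₗ P.d := by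
    refine hx.derivation_ext (f := f₀) (g := f₀) (fun a b => ?_) (fun a b => ?_) fun i => ?_
    · simp [f₁_mul, E.del_smul, E.del_op_smul]
    · simp only [LinearMap.comp_apply, AlgHom.toLinearMap_apply, smul_eq_mul,
        MulOpposite.smul_eq_mul_unop, MulOpposite.unop_op]
      induction a using homogeneous_induction 𝒜 with
      | h k a ha =>
        have := P.map_d_mul f₀.toLinearMap ha b
        simp only [AlgHom.toLinearMap_apply, map_mul] at this
        rw [this]
        by_cases hk : k = 0
        · subst hk; simp [add_comm]
        · simp [f₀_degree k hk a ha]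
      | add a a' h h' => simp only [add_mul, map_add, h, h']; abel
    · by_cases hi : deg i = 1
      · simp [hf₁, hi, hv₁]
      · simp only [LinearMap.comp_apply, hf₁, hi, if_false, map_zero, AlgHom.toLinearMap_apply]
        have hxi := hdeg i
        generalize deg i = k at hi hxi
        match k with
        | 0 => rw [P.d_zero _ hxi, map_zero]
        | k + 1 => rw [f₀_degree k (by omega) _ (P.d_mem k _ hxi)]
  obtain ⟨F, -⟩ := exists_lift_of_truncated f₀ f₁ f₀_degree f₁_degree π_f₀ f₁_mul
    fun a => DFunLike.congr_fun del_f₁ a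
  exact ⟨F⟩

/-- The class of `f₂` does not depend on the morphism of chain algebras `f`. -/
theorem Lift.class_unique [IsScalarTower K R M] [IsScalarTower K Rᵐᵒᵖ M] (f g : E.Lift P)
    {c c' : Shukla P M 3} (hc : Represents P c f.f₂) (hc' : Represents P c' g.f₂) : c = c' := by
  obtain ⟨X, deg, x, hdeg, hx⟩ := P.quasiFree.exists_isFreeOn
  choose v hv using fun i => (E.exact_del_π (f.f₀ (x i) - g.f₀ (x i))).1
    (by rw [map_sub, f.π_f₀, g.π_f₀, sub_self])
  -- A chain homotopy: f₀ - g₀ is a derivation along (f₀, g₀) with values in ker π = im ∂, lifted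
  -- through ∂ on generators.
  obtain ⟨H, hH, H_mul⟩ := hx.exists_derivation f.f₀ g.f₀ fun i => if deg i = 0 then v i else 0
  have H_degree := hx.derivation_degree hdeg f.f₀_degree g.f₀_degree H_mul (n := 0)
    fun i hi => by simp [hH, hi]
  have del_H : E.del ∘ₗ H = f.f₀.toLinearMap - g.f₀.toLinearMap := by
    refine hx.derivation_ext (f := f.f₀) (g := g.f₀) (fun a b => ?_) (fun a b => ?_) fun i => ?_
    · simp [H_mul, E.del_smul, E.del_op_smul]
    · simp only [LinearMap.sub_apply, AlgHom.toLinearMap_apply, map_mul, smul_eq_mul,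
        MulOpposite.smul_eq_mul_unop, MulOpposite.unop_op]
      noncomm_ring
    · by_cases hi : deg i = 0
      · simp [hH, hi, hv]
      · simp [hH, hi, f.f₀_degree _ hi _ (hdeg i), g.f₀_degree _ hi _ (hdeg i)]
  have del_H' : ∀ a, E.del (H a) = f.f₀ a - g.f₀ a := fun a => DFunLike.congr_fun del_H a
  -- The failure of `H` to be a homotopy in degree 1 is killed by ∂, so it lies in M. There f₀ and
  -- g₀ act alike, through ε.
  obtain ⟨u, hu⟩ := LinearMap.exists_factor E.ι_injective (f.f₁ - g.f₁ - H ∘ₗ P.d) fun a =>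
    (E.exact_ι_del _).1 (by simp [f.del_f₁, g.del_f₁, del_H'])
  simp only [LinearMap.sub_apply, LinearMap.comp_apply] at hu
  refine hc.eq_of_derivation hc' (e := u) (fun k hk a ha => E.ι_injective ?_)
    (fun a b => E.ι_injective ?_) fun a => E.ι_injective ?_
  · rw [hu, f.f₁_degree k hk a ha, g.f₁_degree k hk a ha, map_zero]
    match k with
    | 0 => simp [P.d_zero a ha]
    | k + 1 => simp [H_degree k (by omega) _ (P.d_mem k a ha)]
  · have ha' : E.ι (P.ε a • u b) = f.f₀ a • E.ι (u b) := by rw [← f.π_f₀, E.ι_smul]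
    have hb' : E.ι (MulOpposite.op (P.ε b) • u a) = MulOpposite.op (g.f₀ b) • E.ι (u a) := by
      rw [← g.π_f₀, E.ι_op_smul]
    rw [map_add, ha', hb']
    clear ha' hb'
    induction a using homogeneous_induction 𝒜 with
    | h k a ha =>
      -- The crossed identity moves ∂ from f₁ a onto H b, and from g₁ b onto H a in `e₂`, turning
      -- the mixed terms into differences of f₀ and g₀.
      have e₁ : f.f₀ (P.d a) • H b = MulOpposite.op (f.f₀ b - g.f₀ b) • f.f₁ a := by
        rw [← f.del_f₁, E.crossed, del_H']
      have e₂ : MulOpposite.op (g.f₀ (P.d b)) • H a = (f.f₀ a - g.f₀ a) • g.f₁ b := by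
        rw [← g.del_f₁, ← E.crossed, del_H']
      rw [hu, hu, hu, P.map_d_mul H ha, f.f₁_mul, g.f₁_mul, H_mul, H_mul, e₁, e₂]
      by_cases hk : k = 0
      · subst hk
        simp only [P.d_zero a ha, f.f₁_degree 0 (by omega) a ha, g.f₁_degree 0 (by omega) a ha,
          map_zero, smul_zero, pow_zero, one_smul, smul_sub, sub_smul]
        abel
      · simp only [f.f₀_degree k hk a ha, g.f₀_degree k hk a ha,
          MulOpposite.op_sub, smul_sub, sub_smul, zero_smul, smul_zero, zero_add]
        abel
    | add a a' h h' => simp only [add_mul, map_add, h, h', add_smul, smul_add]; abel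
  · rw [map_add, hu, f.ι_f₂, g.ι_f₂, P.d_d, map_zero]
    abel

end Existence

/-! ### Lifts to ∂-extensions -/

namespace DelExtension

/-- As `μ` identifies C₁ with ker σ, the component f₁ is forced by μ f₁ = f₀ d, and its product rule
is the Leibniz rule. -/
theorem exists_lift_of_algHom (X : E.DelExtension) (g : A →ₐ[K] X.S)
    (g_degree : ∀ n, n ≠ 0 → ∀ a ∈ 𝒜 n, g a = 0) (σ_g : ∀ a, X.σ (g a) = P.ε a) :
    ∃ G : X.Lift P, G.f₀ = g := by
  obtain ⟨f₁, hf₁⟩ := LinearMap.exists_factor X.μ_injective (g.toLinearMap ∘ₗ P.d) fun a =>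
    (X.exact _).1 (by simp [σ_g, P.ε_d])
  simp only [LinearMap.comp_apply, AlgHom.toLinearMap_apply] at hf₁
  refine ⟨⟨g, f₁, g_degree, fun n hn a ha => X.μ_injective ?_, σ_g, fun a b => X.μ_injective ?_,
    hf₁, fun a => X.μ_injective ?_⟩, rfl⟩
  · rw [hf₁, map_zero]
    match n with
    | 0 => rw [P.d_zero a ha, map_zero]
    | n + 1 => exact g_degree n (by omega) _ (P.d_mem n a ha)
  · rw [map_add, ← X.mul_μ, ← X.μ_mul]
    induction a using homogeneous_induction 𝒜 with
    | h k a ha =>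
      have := P.map_d_mul g.toLinearMap ha b
      simp only [AlgHom.toLinearMap_apply, map_mul] at this
      rw [hf₁, hf₁, hf₁, this]
      by_cases hk : k = 0
      · subst hk; simp [add_comm]
      · simp [g_degree k hk a ha]
    | add a a' h h' => simp only [add_mul, map_add, h, h']; abel
  · rw [hf₁, P.d_d, map_zero, map_zero]

/-- Every homomorphism `A → C₀` over `R` lifts to a given `∂`-extension. -/
theorem exists_lift_over (X : E.DelExtension) (f₀ : A →ₐ[K] C₀)
    (f₀_degree : ∀ n, n ≠ 0 → ∀ a ∈ 𝒜 n, f₀ a = 0) (π_f₀ : ∀ a, E.π (f₀ a) = P.ε a) :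
    ∃ G : X.Lift P, ∀ a, X.ξ (G.f₀ a) = f₀ a := by
  obtain ⟨I, deg, x, hdeg, hx⟩ := P.quasiFree.exists_isFreeOn
  -- A preimage under σ is right up to ker π = im ∂, and ∂ = ξ μ supplies the correction.
  have surj : ∀ i, ∃ s, X.ξ s = f₀ (x i) := fun i => by
    obtain ⟨s, hs⟩ := X.σ_surjective (P.ε (x i))
    obtain ⟨c, hc⟩ := (E.exact_del_π (f₀ (x i) - X.ξ s)).1 (by
      rw [map_sub, π_f₀, X.π_ξ, hs, sub_self])
    exact ⟨s + X.μ c, by rw [map_add, X.ξ_μ, hc, add_sub_cancel]⟩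
  choose v hv using surj
  obtain ⟨g, hg⟩ := hx.exists_algHom fun i => if deg i = 0 then v i else 0
  have ξ_g : X.ξ.comp g = f₀ := hx.algHom_ext fun i => by
    by_cases hi : deg i = 0
    · simp [hg, hi, hv]
    · simp [hg, hi, f₀_degree _ hi _ (hdeg i)]
  have ξ_g' : ∀ a, X.ξ (g a) = f₀ a := fun a => DFunLike.congr_fun ξ_g a
  obtain ⟨G, rfl⟩ := X.exists_lift_of_algHom (P := P) g
    (hx.algHom_degree hdeg fun i hi => by simp [hg, hi])
    fun a => by rw [← X.π_ξ, ξ_g', π_f₀]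
  exact ⟨G, ξ_g'⟩

namespace Lift

variable {X Y : E.DelExtension}

theorem π_ξ_f₀ (f : X.Lift P) (a : A) : E.π (X.ξ (f.f₀ a)) = P.ε a := by
  rw [X.π_ξ, f.σ_f₀]

theorem ξ_f₀_degree (f : X.Lift P) (n : ℕ) (hn : n ≠ 0) (a : A) (ha : a ∈ 𝒜 n) :
    X.ξ (f.f₀ a) = 0 := by
  rw [f.f₀_degree n hn a ha, map_zero]

theorem del_f₁ (f : X.Lift P) (a : A) : E.del (f.f₁ a) = X.ξ (f.f₀ (P.d a)) := by
  rw [← X.ξ_μ, f.μ_f₁]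

/-- A lift to a `∂`-extension induces a lift to the crossed extension, with `f₂ = 0`. -/
def toBase (f : X.Lift P) : E.Lift P where
  f₀ := X.ξ.comp f.f₀
  f₁ := f.f₁
  f₂ := 0
  f₀_degree := f.ξ_f₀_degree
  f₁_degree := f.f₁_degree
  f₂_degree _ _ _ _ := rfl
  π_f₀ := f.π_ξ_f₀
  f₁_mul := f.f₁_mul
  f₂_mul _ _ := by simp
  del_f₁ := f.del_f₁
  ι_f₂ a := by rw [f.f₁_d]; simp
  f₂_d _ := rfl

/-- The kernel of `A ⊕ C₁ → S`, `(a, c) ↦ f₀(a) + μ(c)`. -/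
theorem f₀_add_μ_eq_zero_iff (f : X.Lift P) (a : A) (c : C₁) :
    f.f₀ a + X.μ c = 0 ↔ ∃ b, c = f.f₁ b ∧ projZero 𝒜 (a + P.d b) = 0 := by
  constructor
  · intro h
    have ha : P.ε a = 0 := by
      have := congrArg X.σ h
      rwa [map_add, (X.exact _).2 ⟨c, rfl⟩, f.σ_f₀, add_zero, map_zero] at this
    obtain ⟨b, hb, hab⟩ := P.exists_d_eq_projZero ha
    refine ⟨-b, X.μ_injective ?_, ?_⟩
    · rw [← algHom_projZero f.f₀_degree, ← hab, ← f.μ_f₁] at h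
      rw [map_neg, map_neg, eq_neg_iff_add_eq_zero, add_comm, h]
    · rw [map_neg, map_add, map_neg, projZero_of_mem (P.d_mem 0 b hb), hab, add_neg_cancel]
  · rintro ⟨b, rfl, hb⟩
    rw [f.μ_f₁, ← map_add, ← algHom_projZero f.f₀_degree, hb, map_zero]

/-- Two `∂`-extensions with lifts that agree over `C₀` and in degree `1` are connected by a
morphism. -/
theorem nonempty_hom [IsScalarTower K C₀ C₁] [IsScalarTower K C₀ᵐᵒᵖ C₁]
    [SMulCommClass C₀ C₀ᵐᵒᵖ C₁] (f : X.Lift P) (g : Y.Lift P)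
    (h₀ : ∀ a, Y.ξ (g.f₀ a) = X.ξ (f.f₀ a)) (h₁ : ∀ a, g.f₁ a = f.f₁ a) : Nonempty (X.Hom Y) := by
  -- Both algebras receive the same semidirect product. The kernel of `p` depends only on f₁, so `q`
  -- factors through `p`.
  let p := Semidirect.lift (f := X.ξ.comp f.f₀) X f.f₀ fun a => rfl
  let q := Semidirect.lift (f := X.ξ.comp f.f₀) Y g.f₀ h₀
  have hpt : ∀ t, p t = f.f₀ t.1 + X.μ t.2 := fun t => rfl
  have hqt : ∀ t, q t = g.f₀ t.1 + Y.μ t.2 := fun t => rfl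
  have p_inl : ∀ a, p (Semidirect.inl E _ a) = f.f₀ a := fun a => by
    rw [hpt, Semidirect.inl_fst, Semidirect.inl_snd, map_zero, add_zero]
  have p_inr : ∀ c, p (Semidirect.inr E _ c) = X.μ c := fun c => by
    rw [hpt, Semidirect.inr_fst, Semidirect.inr_snd, map_zero, zero_add]
  have hp : Function.Surjective p := fun s => by
    obtain ⟨a, ha⟩ := P.ε_surjective (X.σ s)
    obtain ⟨c, hc⟩ := (X.exact (s - f.f₀ a)).1 (by rw [map_sub, f.σ_f₀, ha, sub_self])
    exact ⟨Semidirect.inl E _ a + Semidirect.inr E _ c, by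
      rw [map_add, p_inl, p_inr, hc, add_sub_cancel]⟩
  obtain ⟨φ, hφ⟩ := AlgHom.exists_of_surjective p hp q fun t ht => by
    obtain ⟨b, hb, hb'⟩ := (f.f₀_add_μ_eq_zero_iff t.1 t.2).1 ht
    exact (g.f₀_add_μ_eq_zero_iff t.1 t.2).2 ⟨b, by rw [hb, h₁], hb'⟩
  have hσ : ∀ c, X.σ (X.μ c) = 0 := fun c => (X.exact _).2 ⟨c, rfl⟩
  have hσ' : ∀ c, Y.σ (Y.μ c) = 0 := fun c => (Y.exact _).2 ⟨c, rfl⟩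
  refine ⟨⟨φ, fun c => ?_, fun s => ?_, fun s => ?_⟩⟩
  · rw [← p_inr, hφ, hqt, Semidirect.inr_fst, Semidirect.inr_snd, map_zero, zero_add]
  · obtain ⟨t, rfl⟩ := hp s
    rw [hφ, hqt, hpt, map_add, map_add, hσ, hσ', f.σ_f₀, g.σ_f₀]
  · obtain ⟨t, rfl⟩ := hp s
    rw [hφ, hqt, hpt, map_add, map_add, X.ξ_μ, Y.ξ_μ, h₀]

/-- The difference of two lifts is killed by σ, hence equals μ H; injectivity of μ makes `H` an
exact homotopy, with no error term in M. -/
theorem exists_homotopy (f f' : X.Lift P) :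
    ∃ H : A →ₗ[K] C₁, (∀ k, k ≠ 0 → ∀ a ∈ 𝒜 k, H a = 0) ∧
      (∀ a b, H (a * b) = X.ξ (f'.f₀ a) • H b + MulOpposite.op (X.ξ (f.f₀ b)) • H a) ∧
      (∀ a, E.del (H a) = X.ξ (f'.f₀ a) - X.ξ (f.f₀ a)) ∧
      ∀ a, f'.f₁ a = f.f₁ a + H (P.d a) := by
  obtain ⟨H, hH⟩ := LinearMap.exists_factor X.μ_injective
    (f'.f₀.toLinearMap - f.f₀.toLinearMap) fun a =>
      (X.exact _).1 (by simp [f.σ_f₀, f'.σ_f₀])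
  simp only [LinearMap.sub_apply, AlgHom.toLinearMap_apply] at hH
  refine ⟨H, fun k hk a ha => X.μ_injective ?_, fun a b => X.μ_injective ?_, fun a => ?_,
    fun a => X.μ_injective ?_⟩
  · rw [hH, f.f₀_degree k hk a ha, f'.f₀_degree k hk a ha, map_zero, sub_zero]
  · rw [map_add, ← X.mul_μ, ← X.μ_mul, hH, hH, hH, map_mul, map_mul]
    noncomm_ring
  · rw [← X.ξ_μ, hH, map_sub]
  · rw [map_add, f'.μ_f₁, f.μ_f₁, hH, add_sub_cancel]

/-- Over a common map to C₀, f₁ and g₁ are derivations along the same homomorphism with the same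
image under ∂, and both vanish on boundaries. -/
theorem exists_difference [IsScalarTower K R M] [IsScalarTower K Rᵐᵒᵖ M] (f : X.Lift P)
    (g : Y.Lift P) (hfg : ∀ a, Y.ξ (g.f₀ a) = X.ξ (f.f₀ a)) :
    ∃ (c : Shukla P M 2) (h : A →ₗ[K] M), (∀ a, g.f₁ a = f.f₁ a + E.ι (h a)) ∧
      Represents P c h := by
  obtain ⟨h, hh⟩ := LinearMap.exists_factor E.ι_injective (g.f₁ - f.f₁) fun a =>
    (E.exact_ι_del _).1 (by simp [f.del_f₁, g.del_f₁, hfg])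
  simp only [LinearMap.sub_apply] at hh
  obtain ⟨c, hc⟩ := exists_represents (P := P) (n := 1) (h := h)
    (fun k hk a ha => E.ι_injective (by
      rw [hh, f.f₁_degree k hk a ha, g.f₁_degree k hk a ha, map_zero, sub_zero]))
    (fun a b => E.ι_injective (by
      rw [map_add, ← f.π_ξ_f₀, ← f.π_ξ_f₀, E.ι_smul, E.ι_op_smul, hh, hh, hh, g.f₁_mul, f.f₁_mul,
        hfg, hfg, smul_sub, smul_sub]
      abel))
    (fun a => E.ι_injective (by rw [hh, f.f₁_d, g.f₁_d, map_zero, sub_zero]))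
  exact ⟨c, h, fun a => by rw [hh, add_sub_cancel], hc⟩

/-- A lift to a `∂`-extension changed by a derivation of degree `0` with values in `M`. -/
theorem exists_add_derivation [IsScalarTower K R M] [IsScalarTower K Rᵐᵒᵖ M] (f : X.Lift P)
    {e : A →ₗ[K] M} (hdeg : ∀ k, k ≠ 0 → ∀ a ∈ 𝒜 k, e a = 0)
    (hder : ∀ a b, e (a * b) = P.ε a • e b + MulOpposite.op (P.ε b) • e a) :
    ∃ f' : X.Lift P, (∀ a, X.ξ (f'.f₀ a) = X.ξ (f.f₀ a)) ∧
      ∀ a, f'.f₁ a = f.f₁ a + E.ι (e (P.d a)) := by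
  have del_ι : ∀ m, E.del (E.ι m) = 0 := fun m => (E.exact_ι_del _).2 ⟨m, rfl⟩
  have e1 : e 1 = 0 := by simpa using hder 1 1
  let g : A →ₐ[K] X.S := AlgHom.ofLinearMap (f.f₀.toLinearMap + X.μ ∘ₗ E.ι ∘ₗ e)
    (by simp [e1]) fun a b => by
      -- M has square zero in S because S acts on C₁ through ξ and ξ μ ι = ∂ ι = 0; this makes f₀ +
      -- μ ι e multiplicative.
      have : X.μ (E.ι (e a)) * X.μ (E.ι (e b)) = 0 := by
        rw [X.mul_μ, X.ξ_μ, del_ι, zero_smul, map_zero]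
      simp only [LinearMap.add_apply, LinearMap.comp_apply, AlgHom.toLinearMap_apply, map_mul,
        hder, map_add]
      rw [add_mul, mul_add, mul_add, this, X.mul_μ, X.μ_mul, ← E.ι_smul, ← E.ι_op_smul,
        f.π_ξ_f₀, f.π_ξ_f₀]
      abel
  have hg : ∀ a, g a = f.f₀ a + X.μ (E.ι (e a)) := fun a => rfl
  obtain ⟨f', hf'⟩ := X.exists_lift_of_algHom (P := P) g
    (fun n hn a ha => by rw [hg, f.f₀_degree n hn a ha, hdeg n hn a ha]; simp)
    (fun a => by rw [hg, map_add, (X.exact _).2 ⟨_, rfl⟩, f.σ_f₀, add_zero])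
  refine ⟨f', fun a => by rw [hf', hg, map_add, X.ξ_μ, del_ι, add_zero],
    fun a => X.μ_injective ?_⟩
  rw [f'.μ_f₁, hf', hg, map_add, f.μ_f₁]

end Lift

end DelExtension

end CrossedExtension

end Lifts

/-! ### Construction of `∂`-extensions -/

section Construction

variable {K : Type*} [CommRing K] {R : Type*} [Ring R] [Algebra K R]
variable {A : Type*} [Ring A] [Algebra K A] {𝒜 : ℕ → Submodule K A} [GradedAlgebra 𝒜]

namespace CrossedExtension

variable {M : Type*} [AddCommGroup M] [Module K M] [Module R M] [Module Rᵐᵒᵖ M]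
variable {C₁ : Type*} [AddCommGroup C₁] [Module K C₁]
variable {C₀ : Type*} [Ring C₀] [Algebra K C₀] [Module C₀ C₁] [Module C₀ᵐᵒᵖ C₁]
variable {E : CrossedExtension K R M C₁ C₀} {P : QuasiFreeResolution K R 𝒜}

namespace Lift

/-- This is why `Semidirect.toBase` kills the relations, and it cancels the C₁ terms in the proof
that they form an ideal. -/
theorem f₀_eq_neg_del (F : E.Lift P) {a b : A} (h : projZero 𝒜 (a + P.d b) = 0) :
    F.f₀ a = -E.del (F.f₁ b) := by
  rw [F.del_f₁, eq_neg_iff_add_eq_zero, ← map_add, ← algHom_projZero F.f₀_degree, h, map_zero]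

variable [IsScalarTower K C₀ C₁] [IsScalarTower K C₀ᵐᵒᵖ C₁] [SMulCommClass C₀ C₀ᵐᵒᵖ C₁]

/-- The ideal of `A ⊕ C₁` generated by the elements `(-d b, f₁ b)` and the elements `(a, 0)` with
`a` of positive degree. -/
def relationIdeal (F : E.Lift P) : Ideal (E.Semidirect F.f₀) where
  carrier := {t | ∃ b, t.2 = F.f₁ b ∧ projZero 𝒜 (t.1 + P.d b) = 0}
  zero_mem' := ⟨0, by simp, by simp⟩
  add_mem' := by
    rintro s t ⟨b, h₁, h₂⟩ ⟨b', h₁', h₂'⟩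
    refine ⟨b + b', by rw [Semidirect.add_snd, h₁, h₁', map_add], ?_⟩
    rw [Semidirect.add_fst, map_add P.d, add_add_add_comm, map_add, h₂, h₂', add_zero]
  smul_mem' := by
    rintro s t ⟨b, h₁, h₂⟩
    -- Relations see only degree 0 of the algebra part. The contribution of `s.2` is -f₁(b)∂ acting
    -- on s.2 plus ∂(s.2) f₁(b), which cancels by the crossed identity.
    refine ⟨projZero 𝒜 s.1 * b, ?_, ?_⟩
    · rw [smul_eq_mul, Semidirect.mul_snd, F.f₀_eq_neg_del h₂, h₁, F.f₁_mul,
        F.f₁_degree 0 zero_ne_one _ (projZero_mem _), algHom_projZero F.f₀_degree,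
        MulOpposite.op_neg, neg_smul, E.crossed, smul_zero]
      abel
    · rw [smul_eq_mul, Semidirect.mul_fst, P.d_mul_of_mem_zero (projZero_mem _), map_add, map_mul,
        map_mul, projZero_of_mem (projZero_mem _), ← mul_add, ← map_add, h₂, mul_zero]

instance (F : E.Lift P) : F.relationIdeal.IsTwoSided where
  mul_mem_of_left := by
    rintro t s ⟨b, h₁, h₂⟩
    refine ⟨b * projZero 𝒜 s.1, ?_, ?_⟩
    · rw [Semidirect.mul_snd, F.f₀_eq_neg_del h₂, h₁, F.f₁_mul,
        F.f₁_degree 0 zero_ne_one _ (projZero_mem _), algHom_projZero F.f₀_degree, neg_smul,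
        smul_zero]
      abel
    · rw [Semidirect.mul_fst, P.d_mul_of_mem_zero_right (projZero_mem _), map_add, map_mul,
        map_mul, projZero_of_mem (projZero_mem _), ← add_mul, ← map_add, h₂, zero_mul]

/-- A morphism of chain algebras with `f₂ = 0` comes from a `∂`-extension, the quotient of
`A ⊕ C₁` by the relations. -/
theorem exists_delExtension (F : E.Lift P) (hF : ∀ a, F.f₂ a = 0) :
    ∃ (X : E.DelExtension) (G : X.Lift P), (∀ a, X.ξ (G.f₀ a) = F.f₀ a) ∧
      ∀ a, G.f₁ a = F.f₁ a := by
  let Q := E.Semidirect F.f₀ ⧸ F.relationIdeal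
  let q : E.Semidirect F.f₀ →ₐ[K] Q := Ideal.Quotient.mkₐ K F.relationIdeal
  have hq : Function.Surjective q := Ideal.Quotient.mkₐ_surjective K _
  have hq0 : ∀ t, q t = 0 ↔ ∃ b, t.2 = F.f₁ b ∧ projZero 𝒜 (t.1 + P.d b) = 0 :=
    fun t => Ideal.Quotient.eq_zero_iff_mem
  obtain ⟨σ, hσ⟩ := AlgHom.exists_of_surjective q hq (P.ε.comp (Semidirect.fst E F.f₀))
    fun t ht => by
      obtain ⟨b, -, hb⟩ := (hq0 t).1 ht
      have := congrArg P.ε hb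
      rwa [P.ε_projZero, map_add, P.ε_d, add_zero, map_zero] at this
  obtain ⟨ξ, hξ⟩ := AlgHom.exists_of_surjective q hq (Semidirect.toBase E F.f₀) fun t ht => by
    obtain ⟨b, hb, hb'⟩ := (hq0 t).1 ht
    rw [Semidirect.toBase_apply, F.f₀_eq_neg_del hb', hb, neg_add_cancel]
  have hσ' : ∀ t, σ (q t) = P.ε t.1 := hσ
  have hξ' : ∀ t, ξ (q t) = F.f₀ t.1 + E.del t.2 := hξ
  let μ : C₁ →ₗ[K] Q := q.toLinearMap ∘ₗ Semidirect.inr E F.f₀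
  have hμ : ∀ c, μ c = q (Semidirect.inr E F.f₀ c) := fun c => rfl
  -- If (0, c) is a relation, then c = f₁ b with the degree-1 part of b a cycle, hence a boundary;
  -- f₁ kills boundaries because ι f₂ = f₁ d and f₂ = 0.
  have μ_injective : Function.Injective μ := by
    rw [injective_iff_map_eq_zero]
    intro c hc
    obtain ⟨b, hb, hb'⟩ := (hq0 _).1 hc
    rw [Semidirect.inr_snd] at hb
    rw [Semidirect.inr_fst, zero_add, P.projZero_d] at hb'
    have mem : GradedAlgebra.proj 𝒜 1 b ∈ 𝒜 1 := SetLike.coe_mem _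
    obtain ⟨b', -, hb'⟩ := P.exact_pos 1 one_pos _ mem hb'
    rw [hb, ← comp_proj_eq F.f₁_degree, ← hb', ← F.ι_f₂, hF, map_zero]
  have exact_σ : ∀ s, σ s = 0 ↔ ∃ c, μ c = s := by
    intro s
    obtain ⟨t, rfl⟩ := hq s
    constructor
    · intro ht
      rw [hσ'] at ht
      obtain ⟨b, hb, hbt⟩ := P.exists_d_eq_projZero ht
      -- If a has degree-0 part d b, then (a, c) and (0, c + f₁ b) are congruent.
      refine ⟨t.2 + F.f₁ b, ?_⟩
      rw [hμ, ← sub_eq_zero, ← map_sub, hq0]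
      refine ⟨b, ?_, ?_⟩
      · rw [sub_eq_add_neg, Semidirect.add_snd, Semidirect.inr_snd]
        exact (add_right_comm _ _ _).trans (by
          rw [show (-t).2 = -t.2 from rfl, add_neg_cancel, zero_add])
      · rw [sub_eq_add_neg, Semidirect.add_fst, Semidirect.inr_fst, zero_add,
          show (-t).1 = -t.1 from rfl, map_add, map_neg, projZero_of_mem (P.d_mem 0 b hb), hbt,
          neg_add_cancel]
    · rintro ⟨c, hc⟩
      rw [← hc, hμ, hσ', Semidirect.inr_fst, map_zero]
  have σ_surjective : Function.Surjective σ := by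
    intro r
    obtain ⟨a, rfl⟩ := P.ε_surjective r
    exact ⟨q (Semidirect.inl E F.f₀ a), hσ' _⟩
  have ξ_μ : ∀ c, ξ (μ c) = E.del c := by
    intro c
    rw [hμ, hξ', Semidirect.inr_fst, Semidirect.inr_snd, map_zero, zero_add]
  have π_ξ : ∀ s, E.π (ξ s) = σ s := by
    intro s
    obtain ⟨t, rfl⟩ := hq s
    rw [hξ', hσ', map_add, F.π_f₀, (E.exact_del_π _).2 ⟨_, rfl⟩, add_zero]
  have μ_mul : ∀ c s, μ c * s = μ (MulOpposite.op (ξ s) • c) := by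
    intro c s
    obtain ⟨t, rfl⟩ := hq s
    rw [hμ, hμ, hξ', ← map_mul]
    congr 1
    ext
    · simp
    · rw [Semidirect.mul_snd, Semidirect.inr_fst, Semidirect.inr_snd, Semidirect.inr_snd, map_zero,
        zero_smul, zero_add, E.crossed, MulOpposite.op_add, add_smul]
  have mul_μ : ∀ s c, s * μ c = μ (ξ s • c) := by
    intro s c
    obtain ⟨t, rfl⟩ := hq s
    rw [hμ, hμ, hξ', ← map_mul]
    congr 1
    ext
    · simp
    · rw [Semidirect.mul_snd, Semidirect.inr_fst, Semidirect.inr_snd, Semidirect.inr_snd, map_zero,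
        MulOpposite.op_zero, zero_smul, add_zero, add_smul]
  obtain ⟨X, e, he₁, he₂, he₃⟩ := E.exists_delExtension μ σ ξ μ_injective exact_σ σ_surjective
    ξ_μ π_ξ μ_mul mul_μ
  obtain ⟨G, hG⟩ := X.exists_lift_of_algHom (P := P)
    ((e.toAlgHom.comp q).comp (Semidirect.inl E F.f₀))
    (fun n hn a ha => by
      have : q (Semidirect.inl E F.f₀ a) = 0 := (hq0 _).2 ⟨0, by simp, by
        rw [Semidirect.inl_fst, map_zero, add_zero, projZero_of_ne ha hn]⟩
      simp [this])
    (fun a => (he₂ _).trans (hσ' _))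
  have hG' : ∀ a, G.f₀ a = e (q (Semidirect.inl E F.f₀ a)) := fun a => by rw [hG]; rfl
  refine ⟨X, G, fun a => ?_, fun a => X.μ_injective ?_⟩
  · rw [hG', he₃, hξ', Semidirect.inl_fst, Semidirect.inl_snd, map_zero, add_zero]
  · rw [G.μ_f₁, hG', he₁, hμ, e.injective.eq_iff, ← sub_eq_zero, ← map_sub, hq0]
    -- The element (d a, -f₁ a) is the relation attached to -a.
    refine ⟨-a, ?_, ?_⟩
    · rw [map_neg, sub_eq_add_neg, Semidirect.add_snd, Semidirect.inl_snd, zero_add]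
      rfl
    · rw [map_neg, sub_eq_add_neg, Semidirect.add_fst, Semidirect.inl_fst, ← map_neg,
        Semidirect.inr_fst, add_zero, add_neg_cancel, map_zero]

end Lift

end CrossedExtension

end Construction

/-! ### Difference classes and the action of `Shukla²` -/

section Difference

variable {K : Type*} [CommRing K] {R : Type*} [Ring R] [Algebra K R]
variable {A : Type*} [Ring A] [Algebra K A] {𝒜 : ℕ → Submodule K A} [GradedAlgebra 𝒜]

namespace CrossedExtension

variable {M : Type*} [AddCommGroup M] [Module K M] [Module R M] [Module Rᵐᵒᵖ M]
variable {C₁ : Type*} [AddCommGroup C₁] [Module K C₁]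
variable {C₀ : Type*} [Ring C₀] [Algebra K C₀] [Module C₀ C₁] [Module C₀ᵐᵒᵖ C₁]
variable {E : CrossedExtension K R M C₁ C₀} {P : QuasiFreeResolution K R 𝒜}
variable {X Y Z : E.DelExtension}

theorem DelExtension.nonempty_lift [IsScalarTower K C₀ C₁]
    [IsScalarTower K C₀ᵐᵒᵖ C₁] [SMulCommClass C₀ C₀ᵐᵒᵖ C₁] (X : E.DelExtension) (P : QuasiFreeResolution K R 𝒜) :
    Nonempty (X.Lift P) := by
  obtain ⟨F⟩ := E.nonempty_lift P
  obtain ⟨G, -⟩ := X.exists_lift_over F.f₀ F.f₀_degree F.π_f₀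
  exact ⟨G⟩

variable [IsScalarTower K R M] [IsScalarTower K Rᵐᵒᵖ M]

/-- Changing the lifts gives homotopies H on X and G on Y with the same image under ∂. Thus G - H is
an M-valued derivation of degree 0, and its composite with d is h - h'. -/
theorem IsDifference.unique {c c' : Shukla P M 2} (hc : IsDifference P X Y c)
    (hc' : IsDifference P X Y c') : c = c' := by
  obtain ⟨f, g, h, hfg, hh, hr⟩ := hc
  obtain ⟨f', g', h', hfg', hh', hr'⟩ := hc'
  obtain ⟨H, H_degree, H_mul, del_H, hH⟩ := f'.exists_homotopy f
  obtain ⟨G, G_degree, G_mul, del_G, hG⟩ := g'.exists_homotopy g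
  obtain ⟨e, he⟩ := LinearMap.exists_factor E.ι_injective (G - H) fun a =>
    (E.exact_ι_del _).1 (by simp [del_H, del_G, hfg, hfg'])
  simp only [LinearMap.sub_apply] at he
  refine hr.eq_of_derivation hr' (e := e) (fun k hk a ha => E.ι_injective ?_)
    (fun a b => E.ι_injective ?_) fun a => E.ι_injective ?_
  · rw [he, G_degree k hk a ha, H_degree k hk a ha, map_zero, sub_zero]
  · rw [map_add, ← f.π_ξ_f₀, ← f'.π_ξ_f₀, E.ι_smul, E.ι_op_smul, he, he, he, G_mul, H_mul, hfg,
      hfg', smul_sub, smul_sub]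
    abel
  · have h₁ := hh a
    rw [hG, hH, hh'] at h₁
    rw [map_add, he, ← sub_eq_zero, ← neg_eq_zero, ← sub_eq_zero.2 h₁]
    abel

theorem isDifference_self (X : E.DelExtension) (f : X.Lift P) :
    IsDifference P X X (0 : Shukla P M 2) :=
  ⟨f, f, 0, fun _ => rfl, fun a => by simp, represents_zero⟩

/-- A lift to Z is chosen over the same map to C₀ as the middle lift; uniqueness identifies its
difference with c', and the derivations then add. -/
theorem IsDifference.add {c c' : Shukla P M 2} (hc : IsDifference P X Y c)
    (hc' : IsDifference P Y Z c') : IsDifference P X Z (c + c') := by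
  obtain ⟨f, g, h, hfg, hh, hr⟩ := hc
  obtain ⟨k, hk⟩ := Z.exists_lift_over (P := P) (Y.ξ.comp g.f₀) g.ξ_f₀_degree g.π_ξ_f₀
  obtain ⟨c'', h', hh', hr'⟩ := g.exists_difference k hk
  obtain rfl : c'' = c' := IsDifference.unique ⟨g, k, h', hk, hh', hr'⟩ hc'
  exact ⟨f, k, h + h', fun a => (hk a).trans (hfg a), fun a => by
    rw [hh', hh, LinearMap.add_apply, map_add, add_assoc], hr.add hr'⟩

variable [IsScalarTower K C₀ C₁] [IsScalarTower K C₀ᵐᵒᵖ C₁] [SMulCommClass C₀ C₀ᵐᵒᵖ C₁]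

theorem exists_isDifference (P : QuasiFreeResolution K R 𝒜) (X Y : E.DelExtension) :
    ∃ c : Shukla P M 2, IsDifference P X Y c := by
  obtain ⟨f⟩ := X.nonempty_lift P
  obtain ⟨g, hg⟩ := Y.exists_lift_over (P := P) (X.ξ.comp f.f₀) f.ξ_f₀_degree f.π_ξ_f₀
  obtain ⟨c, h, hh, hr⟩ := f.exists_difference g hg
  exact ⟨c, f, g, h, hg, hh, hr⟩

/-- Adding ι h to f₁ keeps f₂ = 0, as h kills boundaries, so the quotient construction returns a
∂-extension. -/
theorem exists_isDifference_of_class [SMulCommClass R Rᵐᵒᵖ M] (X : E.DelExtension)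
    (c : Shukla P M 2) : ∃ Y : E.DelExtension, IsDifference P X Y c := by
  obtain ⟨h, hr, hdeg, hder, hd⟩ := exists_represents_of_shukla_two c
  obtain ⟨f⟩ := X.nonempty_lift P
  obtain ⟨F, h₀, h₁, h₂⟩ := f.toBase.exists_sub (v := -h)
    (fun k hk a ha => by rw [LinearMap.neg_apply, hdeg k hk a ha, neg_zero])
    (fun a b => by simp only [LinearMap.neg_apply, hder, smul_neg]; abel)
  obtain ⟨Y, g, hg₀, hg₁⟩ := F.exists_delExtension fun a => by
    rw [h₂, LinearMap.neg_apply, hd, neg_zero, sub_zero]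
    rfl
  refine ⟨Y, f, g, h, fun a => ?_, fun a => ?_, hr⟩
  · rw [hg₀, h₀]; rfl
  · rw [hg₁, h₁, LinearMap.neg_apply, map_neg, sub_neg_eq_add]; rfl

theorem DelExtension.Hom.isDifference (P : QuasiFreeResolution K R 𝒜) (φ : X.Hom Y) :
    IsDifference P X Y (0 : Shukla P M 2) := by
  obtain ⟨f⟩ := X.nonempty_lift P
  obtain ⟨g, hg⟩ := Y.exists_lift_of_algHom (P := P) (φ.φ.comp f.f₀)
    (fun n hn a ha => by rw [AlgHom.comp_apply, f.f₀_degree n hn a ha, map_zero])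
    (fun a => by rw [AlgHom.comp_apply, φ.σ_φ, f.σ_f₀])
  refine ⟨f, g, 0, fun a => ?_, fun a => Y.μ_injective ?_, represents_zero⟩
  · rw [hg, AlgHom.comp_apply, φ.ξ_φ]
  · rw [g.μ_f₁, hg, AlgHom.comp_apply, ← f.μ_f₁, φ.φ_μ, LinearMap.zero_apply, map_zero, add_zero]

/-- A cochain bounding h is a degree-0 derivation e, absorbed by changing f₀ to f₀ + μ ι e. The
lifts then agree in degree 1, so a single morphism exists rather than a zigzag. -/
theorem IsDifference.nonempty_hom (h : IsDifference P X Y (0 : Shukla P M 2)) :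
    Nonempty (X.Hom Y) := by
  obtain ⟨f, g, h, hfg, hh, hr⟩ := h
  obtain ⟨z, hz, hzh⟩ := (hr.congr_iff (represents_zero (P := P))).1 rfl
  obtain ⟨e, hdeg, hder, he⟩ := exists_derivation_of_totalCochains_one P hz hzh
  obtain ⟨f', h₀, h₁⟩ := f.exists_add_derivation hdeg hder
  exact f'.nonempty_hom g (fun a => by rw [hfg, h₀]) fun a => by
    rw [hh, h₁, ← he, sub_zero]

/-- Two `∂`-extensions are in the same component if and only if their difference vanishes. -/
theorem component_eq_iff (P : QuasiFreeResolution K R 𝒜) :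
    X.component = Y.component ↔ IsDifference P X Y (0 : Shukla P M 2) := by
  refine ⟨fun h => ?_, fun h => Quot.sound h.nonempty_hom⟩
  replace h := Quot.eqvGen_exact h
  induction h with
  | rel X Y h => exact h.some.isDifference P
  | refl X => exact isDifference_self X (X.nonempty_lift P).some
  | symm X Y _ ih =>
    have hXY := ih
    -- By additivity this class is a difference of X with itself, hence zero.
    obtain ⟨c, hc⟩ := exists_isDifference P Y X
    have := (hXY.add hc).unique (isDifference_self X (X.nonempty_lift P).some)
    rw [zero_add] at this
    exact this ▸ hc
  | trans X Y Z _ _ ih ih' => simpa using ih.add ih'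

/-- The axioms follow formally from the difference being defined for every pair, unique, additive,
and zero exactly within a component. The representatives and translates are chosen arbitrarily;
`key` removes the dependence. -/
theorem exists_addAction [SMulCommClass R Rᵐᵒᵖ M] (E : CrossedExtension K R M C₁ C₀)
    (P : QuasiFreeResolution K R 𝒜) :
    ∃ _ : AddAction (Shukla P M 2) E.DelExt,
      ∀ (X Y : E.DelExtension) (c : Shukla P M 2),
        c +ᵥ X.component = Y.component ↔ IsDifference P X Y c := by
  choose translate h_translate using
    fun (X : E.DelExtension) (c : Shukla P M 2) => exists_isDifference_of_class X c
  have out_component : ∀ x : E.DelExt, (Quot.out x).component = x := Quot.out_eq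
  have key : ∀ (X Y : E.DelExtension) (c : Shukla P M 2),
      (translate (Quot.out X.component) c).component = Y.component ↔ IsDifference P X Y c := by
    intro X Y c
    have h₀ : IsDifference P X (Quot.out X.component) 0 :=
      (component_eq_iff P).1 (out_component _).symm
    have h₁ := h₀.add (h_translate (Quot.out X.component) c)
    rw [zero_add] at h₁
    rw [component_eq_iff P]
    refine ⟨fun h => by simpa using h₁.add h, fun h => ?_⟩
    obtain ⟨c', hc'⟩ := exists_isDifference P (translate (Quot.out X.component) c) Y
    have := (h₁.add hc').unique h
    rw [add_eq_left] at this
    exact this ▸ hc'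
  refine ⟨{ vadd := fun c x => (translate (Quot.out x) c).component
            zero_vadd := ?_
            add_vadd := ?_ }, key⟩
  · rintro c c' ⟨X⟩
    obtain ⟨Y, hY⟩ := exists_isDifference_of_class X c'
    obtain ⟨Z, hZ⟩ := exists_isDifference_of_class Y c
    have e₁ := (key X Y c').2 hY
    have e₂ := (key Y Z c).2 hZ
    have e₃ := (key X Z (c + c')).2 (add_comm c' c ▸ hY.add hZ)
    refine e₃.trans ?_
    change _ = (translate (Quot.out (translate (Quot.out X.component) c').component) c).component
    rw [e₁, e₂]
  · rintro ⟨X⟩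
    exact (key X X 0).2 ((component_eq_iff P).1 rfl)

/-- The class of a crossed extension vanishes if and only if there is a `∂`-extension. -/
theorem Lift.represents_zero_iff [SMulCommClass R Rᵐᵒᵖ M] (F : E.Lift P) {c : Shukla P M 3}
    (hc : Represents P c F.f₂) : c = 0 ↔ Nonempty E.DelExt := by
  constructor
  · intro h
    obtain ⟨z, hz, hzh⟩ := (hc.congr_iff (represents_zero (P := P))).1 h
    obtain ⟨-, v, -, -, hdeg, hder, hv⟩ := exists_derivation_of_totalCochains_two P hz hzh
    obtain ⟨F', -, -, h₂⟩ := F.exists_sub hdeg hder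
    obtain ⟨X, -⟩ := F'.exists_delExtension fun a => by rw [h₂, ← hv, sub_zero, sub_self]
    exact ⟨X.component⟩
  · rintro ⟨⟨X⟩⟩
    obtain ⟨f⟩ := X.nonempty_lift P
    -- The lift induced from a ∂-extension has f₂ = 0, and the class does not depend on the lift.
    exact F.class_unique f.toBase hc represents_zero

end CrossedExtension

end Difference

/-! ### The main theorem -/

theorem mainTheorem4 {K : Type*} [CommRing K] {R : Type*} [Ring R] [Algebra K R]
    {M : Type*} [AddCommGroup M] [Module K M] [Module R M] [Module Rᵐᵒᵖ M]
    [IsScalarTower K R M] [IsScalarTower K Rᵐᵒᵖ M] [SMulCommClass R Rᵐᵒᵖ M]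
    {C₀ : Type*} [Ring C₀] [Algebra K C₀]
    {C₁ : Type*} [AddCommGroup C₁] [Module K C₁] [Module C₀ C₁] [Module C₀ᵐᵒᵖ C₁]
    [IsScalarTower K C₀ C₁] [IsScalarTower K C₀ᵐᵒᵖ C₁] [SMulCommClass C₀ C₀ᵐᵒᵖ C₁]
    (E : CrossedExtension K R M C₁ C₀)
    {A : Type*} [Ring A] [Algebra K A] {𝒜 : ℕ → Submodule K A} [GradedAlgebra 𝒜]
    (P : QuasiFreeResolution K R 𝒜) :
    (∃ c : Shukla P M 3, (∀ c', E.IsClass P c' ↔ c' = c) ∧ (c = 0 ↔ Nonempty E.DelExt)) ∧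
    (Nonempty E.DelExt → ∃ _ : AddAction (Shukla P M 2) E.DelExt,
      (∀ (X Y : E.DelExtension) (c : Shukla P M 2),
        c +ᵥ X.component = Y.component ↔ CrossedExtension.IsDifference P X Y c) ∧
      (∀ x y : E.DelExt, ∃ c : Shukla P M 2, c +ᵥ x = y) ∧
      (∀ (c : Shukla P M 2) (x : E.DelExt), c +ᵥ x = x → c = 0)) := by
  refine ⟨?_, fun _ => ?_⟩
  · obtain ⟨F⟩ := E.nonempty_lift P
    obtain ⟨c, hc⟩ := exists_represents F.f₂_degree F.f₂_mul F.f₂_d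
    refine ⟨c, fun c' => ⟨?_, ?_⟩, F.represents_zero_iff hc⟩
    · rintro ⟨G, hG⟩
      exact G.class_unique F hG hc
    · rintro rfl
      exact ⟨F, hc⟩
  · obtain ⟨action, h⟩ := E.exists_addAction P
    refine ⟨action, h, ?_, ?_⟩
    · rintro ⟨X⟩ ⟨Y⟩
      obtain ⟨c, hc⟩ := CrossedExtension.exists_isDifference P X Y
      exact ⟨c, (h X Y c).2 hc⟩
    · rintro c ⟨X⟩ hc
      exact ((h X X c).1 hc).unique ((CrossedExtension.component_eq_iff P).1 rfl)
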